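/- Fix $\hbar=1$ and let $d\in\mathbb{N}$. Write $X=(x,\xi)\in\mathbb{R}^{2d}$ and $\langle X\rangle=(1+|X|^2)^{1/2}$. For $\mu,\delta\in\mathbb{R}$ with $\delta<1$, let $\mathbb{S}^\mu_\delta$ be the set of $A\in C^\infty(\mathbb{R}^{2d};\mathbb{C})$ such that for every multi-index $\gamma\in\mathbb{N}^{2d}$ there is a constant $C_\gamma$ with $|\partial_X^\gamma A(X)|\le C_\gamma\langle X\rangle^{\mu+\delta|\gamma|}$ for all $X\in\mathbb{R}^{2d}$. The Poisson bracket of smooth functions is $\{A,B\}=\partial_\xi A\cdot\partial_x B-\partial_x A\cdot\partial_\xi B$. The Weyl quantization of $A\in\mathbb{S}^\mu_\delta$ is the operator $$\widehat A f(x)=(2\pi)^{-d}\int_{\mathbb{R}^d}\left(\int_{\mathbb{R}^d}A\Big(\frac{x+y}{2},\xi\Big)e^{i\xi\cdot(x-y)}f(y)\,dy\right)d\xi,\qquad f\in\mathcal{S}(\mathbb{R}^d).$$ The Moyal bracket $\{A,H\}_\circledast$ is the Weyl symbol of $i[\widehat A,\widehat H]$, that is, the symbol (in some class $\mathbb{S}^{\mu'}_{\delta'}$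 with $\delta'<1$) whose Weyl quantization, as an operator on $\mathcal{S}(\mathbb{R}^d)$, is $i(\widehat A\widehat H-\widehat H\widehat A)$. Theorem. Let $H\in\mathbb{S}^\mu_\delta$ for some $\mu\in\mathbb{R}$ and some $\delta<1/2$. Suppose that $\{A,H\}_\circledast=\{A,H\}$ for every $A\in\mathcal{S}(\mathbb{R}^{2d})$. Then $H$ is a polynomial in $X=(x,\xi)$ of degree at most $2$. -/

import Mathlib

open scoped ContDiff

noncomputable section

namespace MoyalPoisson

/-- The configuration space `ℝ^d` with its Euclidean norm. -/
abbrev Config (d : ℕ) := EuclideanSpace ℝ (Fin d)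

/-- The phase space `ℝ^{2d}`; a point is `X = (x, ξ)`. -/
abbrev Phase (d : ℕ) := Config d × Config d

/-- `⟨X⟩ = (1 + |x|² + |ξ|²)^{1/2}`. -/
def japaneseBracket {d : ℕ} (X : Phase d) : ℝ :=
  Real.sqrt (1 + ‖X.1‖ ^ 2 + ‖X.2‖ ^ 2)

/-- The symbol class `S^μ_δ`: smooth functions on phase space all of whose derivatives of order `n`
are bounded by a constant (depending on `n`) times `⟨X⟩^{μ + δ n}`. The derivatives of order `n` are
measured by the norm of the `n`-th Fréchet derivative, which is comparable to the maximum of the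
partial derivatives `|∂^γ A(X)|`, `|γ| = n`. -/
def IsSymbol {d : ℕ} (μ δ : ℝ) (A : Phase d → ℂ) : Prop :=
  ContDiff ℝ ∞ A ∧
    ∀ n : ℕ, ∃ C : ℝ, ∀ X : Phase d,
      ‖iteratedFDeriv ℝ n A X‖ ≤ C * japaneseBracket X ^ (μ + δ * n)

/-- The partial derivative `∂A/∂x_j`. -/
def partialX {d : ℕ} (j : Fin d) (A : Phase d → ℂ) (X : Phase d) : ℂ :=
  fderiv ℝ A X (EuclideanSpace.single j 1, 0)

/-- The partial derivative `∂A/∂ξ_j`. -/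
def partialXi {d : ℕ} (j : Fin d) (A : Phase d → ℂ) (X : Phase d) : ℂ :=
  fderiv ℝ A X (0, EuclideanSpace.single j 1)

/-- The Poisson bracket `{A, B} = ∂_ξ A · ∂_x B - ∂_x A · ∂_ξ B`. -/
def poissonBracket {d : ℕ} (A B : Phase d → ℂ) (X : Phase d) : ℂ :=
  ∑ j : Fin d, (partialXi j A X * partialX j B X - partialX j A X * partialXi j B X)

/-- The Weyl quantization with `ħ = 1`:
`(Op A) f (x) = (2π)^{-d} ∫ (∫ A((x + y)/2, ξ) e^{i ξ·(x - y)} f(y) dy) dξ`.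
When `A` lies in `S^μ_δ` with `δ < 1` and `f` is a Schwartz function, the inner integral converges
absolutely and decays faster than any power of `ξ`, so that the outer one converges absolutely. -/
def weylOp {d : ℕ} (A : Phase d → ℂ) (f : Config d → ℂ) (x : Config d) : ℂ :=
  ((2 * Real.pi : ℝ) : ℂ)⁻¹ ^ d *
    ∫ ξ : Config d, ∫ y : Config d,
      A ((1 / 2 : ℝ) • (x + y), ξ) * Complex.exp (Complex.I * ((inner ℝ ξ (x - y) : ℝ) : ℂ)) * f y

/-- `C` is the Weyl symbol of the operator `T` on Schwartz functions: `C` belongs to a symbol class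
(of type `δ < 1`), and `T = Op C`. -/
def IsWeylSymbol {d : ℕ} (C : Phase d → ℂ) (T : (Config d → ℂ) → Config d → ℂ) : Prop :=
  (∃ μ δ : ℝ, δ < 1 ∧ IsSymbol μ δ C) ∧
    ∀ (f : SchwartzMap (Config d) ℂ) (x : Config d), T f x = weylOp C f x

/-- The operator `i [Op A, Op B] = i (Op A ∘ Op B - Op B ∘ Op A)`. -/
def quantumBracket {d : ℕ} (A B : Phase d → ℂ) (f : Config d → ℂ) (x : Config d) : ℂ :=
  Complex.I * (weylOp A (weylOp B f) x - weylOp B (weylOp A f) x)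

/-- `C` is the Moyal bracket of `A` and `B`, that is, the Weyl symbol of `i [Op A, Op B]`. -/
def IsMoyalBracket {d : ℕ} (A B C : Phase d → ℂ) : Prop :=
  IsWeylSymbol C (quantumBracket A B)

/-- `H` is a polynomial of total degree at most `m` in the `2d` coordinates of `X = (x, ξ)`. -/
def IsPolynomialOfDegreeLE {d : ℕ} (m : ℕ) (H : Phase d → ℂ) : Prop :=
  ∃ P : MvPolynomial (Fin d ⊕ Fin d) ℂ, P.totalDegree ≤ m ∧
    ∀ X : Phase d,
      H X = MvPolynomial.eval
        (Sum.elim (fun j => ((X.1 j : ℝ) : ℂ)) (fun j => ((X.2 j : ℝ) : ℂ))) P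

end MoyalPoisson

end

noncomputable section

open MeasureTheory Complex SchwartzMap FourierTransform LineDeriv

namespace MoyalPoisson

variable {d : ℕ}

/-! Test the hypothesis, formally, on a plane wave e_z(X) = e^{i(p·x + q·ξ)}, z = (p, q), and put Z
= (q/2, -p/2). Since Op(e_z) is a phase space translation up to a phase, Op(e_z)Op(H) and
Op(H)Op(e_z) have the symbols e_z H(· + Z) and e_z H(· - Z), while {e_z, H} = 2i e_z DH·Z. Equality
of the brackets therefore means H(X + Z) - H(X - Z) = 2 DH(X)Z for all X and Z
(`symmetric_difference_eq`). Differentiating in Z shows that DH preserves midpoints; being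
continuous it is affine, so H is quadratic (`eq_quadratic_of_symmetric_difference`).

Plane waves are not Schwartz functions, so the test symbols are hat φ ⊗ hat ψ, the superpositions of
the e_z with density φ(p)ψ(q). By `IsTame.weylOp_tensor_weylOp`, `IsTame.weylOp_weylOp_tensor` and
`IsTame.weylOp_tensor_mul`, the operators involved are integrals of φ(p)ψ(q) against `weylAvg` with
s = 1/2, -1/2 and 0. As φ and ψ are arbitrary, the identity holds for each z
(`weylAvg_identity_of_bracket`).

It remains to pass from operators to symbols: `eq_zero_of_weyl_eq_zero`. Pairing Op(F) with Gaussian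
wave packets yields the Fourier transform of F times a Gaussian, at every frequency.

All integrals over ξ converge only after integration over y, where smoothness of the symbol is
traded for decay; `IsTame` records the exact number of derivatives that this needs. -/

/-- The unimodular phase `e^{it}`. -/
def phase (t : ℝ) : ℂ := Complex.exp (Complex.I * (t : ℂ))

lemma phase_add (s t : ℝ) : phase (s + t) = phase s * phase t := by
  simp [phase, mul_add, Complex.exp_add]

@[simp] lemma norm_phase (t : ℝ) : ‖phase t‖ = 1 := by
  rw [phase, mul_comm, Complex.norm_exp_ofReal_mul_I]

lemma phase_ne_zero (t : ℝ) : phase t ≠ 0 := Complex.exp_ne_zero _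

lemma continuous_phase : Continuous phase := by
  unfold phase; fun_prop

@[fun_prop] lemma _root_.Continuous.phase {X : Type*} [TopologicalSpace X] {f : X → ℝ}
    (hf : Continuous f) : Continuous fun x => phase (f x) :=
  continuous_phase.comp hf

/-! ### Weights and Schwartz decay -/

/-- The integrable weight `(1 + |x|)^{-(d+1)}` on `ℝ^d`. -/
def decayWeight (x : Config d) : ℝ := ((1 + ‖x‖) ^ (d + 1))⁻¹

lemma decayWeight_pos (x : Config d) : 0 < decayWeight x := by
  unfold decayWeight; positivity

lemma integrable_decayWeight : Integrable (decayWeight (d := d)) := by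
  have h := integrable_one_add_norm (E := Config d) (μ := volume) (r := (d + 1 : ℕ)) (by simp)
  refine h.congr (Filter.Eventually.of_forall fun x => ?_)
  simp only [decayWeight]
  rw [Real.rpow_neg (by positivity), Real.rpow_natCast]

lemma one_add_norm_add_le {V : Type*} [SeminormedAddCommGroup V] (x y : V) :
    1 + ‖x + y‖ ≤ (1 + ‖x‖) * (1 + ‖y‖) := by
  nlinarith [norm_add_le x y, norm_nonneg x, norm_nonneg y, mul_nonneg (norm_nonneg x) (norm_nonneg y)]

lemma one_add_norm_smul_le {V : Type*} [SeminormedAddCommGroup V] [NormedSpace ℝ V] (c : ℝ) (y : V) :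
    1 + ‖c • y‖ ≤ (1 + |c|) * (1 + ‖y‖) := by
  rw [norm_smul, Real.norm_eq_abs]
  nlinarith [abs_nonneg c, norm_nonneg y]

lemma SchwartzMap.exists_one_add_pow_mul_le (f : 𝓢(Config d, ℂ)) (k n : ℕ) :
    ∃ C : ℝ, 0 ≤ C ∧ ∀ x, (1 + ‖x‖) ^ k * ‖iteratedFDeriv ℝ n f x‖ ≤ C := by
  refine ⟨_, ?_, fun x => SchwartzMap.one_add_le_sup_seminorm_apply (𝕜 := ℝ) (m := (k, n))
    le_rfl le_rfl f x⟩
  positivity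

lemma SchwartzMap.exists_norm_le_decayWeight (f : 𝓢(Config d, ℂ)) (a n : ℕ) :
    ∃ C : ℝ, 0 ≤ C ∧ ∀ x, (1 + ‖x‖) ^ a * ‖iteratedFDeriv ℝ n f x‖ ≤ C * decayWeight x := by
  obtain ⟨C, hC, h⟩ := SchwartzMap.exists_one_add_pow_mul_le f (a + (d + 1)) n
  refine ⟨C, hC, fun x => ?_⟩
  rw [decayWeight, ← div_eq_mul_inv, le_div_iff₀ (by positivity)]
  calc _ = (1 + ‖x‖) ^ (a + (d + 1)) * ‖iteratedFDeriv ℝ n f x‖ := by ring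
    _ ≤ C := h x

/-! ### Tensor products and the Fourier transform in angular frequency -/

/-- The tensor product of two Schwartz functions, as a Schwartz function on phase space. -/
def tensor (φ ψ : 𝓢(Config d, ℂ)) : 𝓢(Phase d, ℂ) where
  toFun X := φ X.1 * ψ X.2
  smooth' := (φ.smooth ⊤).comp contDiff_fst |>.mul ((ψ.smooth ⊤).comp contDiff_snd)
  decay' k n := by
    choose C1 hC1 h1 using fun j i => SchwartzMap.exists_one_add_pow_mul_le φ j i
    choose C2 hC2 h2 using fun j i => SchwartzMap.exists_one_add_pow_mul_le ψ j i
    refine ⟨∑ i ∈ Finset.range (n + 1), n.choose i * (C1 k i * C2 k (n - i)), fun X => ?_⟩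
    have hφ : ContDiff ℝ ∞ (fun X : Phase d => φ X.1) := (φ.smooth ⊤).comp contDiff_fst
    have hψ : ContDiff ℝ ∞ (fun X : Phase d => ψ X.2) := (ψ.smooth ⊤).comp contDiff_snd
    have key : ∀ (L : Phase d →L[ℝ] Config d) (_ : ‖L‖ ≤ 1) (f : 𝓢(Config d, ℂ)) (i : ℕ),
        ‖iteratedFDeriv ℝ i (fun X : Phase d => f (L X)) X‖ ≤ ‖iteratedFDeriv ℝ i f (L X)‖ := by
      intro L hL f i
      have := L.iteratedFDeriv_comp_right (f := f) (f.smooth i) X (i := i) le_rfl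
      rw [show (fun X : Phase d => f (L X)) = f ∘ L from rfl, this]
      refine (ContinuousMultilinearMap.norm_compContinuousLinearMap_le _ _).trans ?_
      simp only [Finset.prod_const, Finset.card_univ, Fintype.card_fin]
      exact mul_le_of_le_one_right (norm_nonneg _) (pow_le_one₀ (norm_nonneg _) hL)
    have hle := norm_iteratedFDeriv_mul_le hφ hψ X (n := n) (mod_cast le_top)
    have hX : ‖X‖ ≤ (1 + ‖X.1‖) * (1 + ‖X.2‖) := by
      rw [Prod.norm_def]
      refine max_le ?_ ?_ <;> nlinarith [norm_nonneg X.1, norm_nonneg X.2,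
        mul_nonneg (norm_nonneg X.1) (norm_nonneg X.2)]
    calc _ ≤ ((1 + ‖X.1‖) * (1 + ‖X.2‖)) ^ k * ∑ i ∈ Finset.range (n + 1),
          (n.choose i : ℝ) * ‖iteratedFDeriv ℝ i φ X.1‖ * ‖iteratedFDeriv ℝ (n - i) ψ X.2‖ := by
          gcongr
          refine hle.trans (Finset.sum_le_sum fun i _ => ?_)
          gcongr
          · exact key (ContinuousLinearMap.fst ℝ _ _) (ContinuousLinearMap.norm_fst_le ..) φ i
          · exact key (ContinuousLinearMap.snd ℝ _ _) (ContinuousLinearMap.norm_snd_le ..) ψ (n - i)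
      _ = ∑ i ∈ Finset.range (n + 1), n.choose i * (((1 + ‖X.1‖) ^ k * ‖iteratedFDeriv ℝ i φ X.1‖) *
          ((1 + ‖X.2‖) ^ k * ‖iteratedFDeriv ℝ (n - i) ψ X.2‖)) := by
          rw [Finset.mul_sum]
          refine Finset.sum_congr rfl fun i _ => ?_
          rw [mul_pow]; ring
      _ ≤ _ := by
          refine Finset.sum_le_sum fun i _ => ?_
          gcongr
          · exact hC1 _ _
          · exact h1 _ _ _
          · exact h2 _ _ _

@[simp] lemma tensor_apply (φ ψ : 𝓢(Config d, ℂ)) (X : Phase d) :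
    tensor φ ψ X = φ X.1 * ψ X.2 := rfl

/-- Dilation of `ℝ^d` by `(2π)⁻¹`. -/
def dilation (d : ℕ) : Config d ≃L[ℝ] Config d :=
  ContinuousLinearEquiv.smulLeft (Units.mk0 ((2 * Real.pi)⁻¹ : ℝ) (by positivity))

@[simp] lemma dilation_apply (x : Config d) : dilation d x = (2 * Real.pi)⁻¹ • x := rfl

/-- The Fourier transform `x ↦ ∫ φ(p) e^{i p·x} dp`. -/
def hat (φ : 𝓢(Config d, ℂ)) : 𝓢(Config d, ℂ) :=
  compCLMOfContinuousLinearEquiv ℂ (dilation d) (𝓕⁻ φ)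

lemma hat_apply (φ : 𝓢(Config d, ℂ)) (x : Config d) :
    hat φ x = ∫ p, φ p * phase (inner ℝ p x) := by
  simp only [hat, compCLMOfContinuousLinearEquiv_apply, Function.comp_apply, fourierInv_coe,
    Real.fourierInv_eq', dilation_apply, inner_smul_right]
  congr with p
  rw [phase, smul_eq_mul, mul_comm]
  congr 2
  rw [mul_comm]
  congr 2
  field_simp

/-- Fourier inversion; the factor (2π)^{-d} cancels the Jacobian of the dilation relating `hat` to
Mathlib's `𝓕⁻`. -/
lemma integral_hat_mul_phase (φ : 𝓢(Config d, ℂ)) (v : Config d) :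
    ((2 * Real.pi : ℝ) : ℂ)⁻¹ ^ d * ∫ ξ, hat φ ξ * phase (-inner ℝ ξ v) = φ v := by
  have h1 : ∀ ξ : Config d, hat φ ξ * phase (-inner ℝ ξ v) =
      (fun w => 𝓕⁻ φ w * phase (-(2 * Real.pi * inner ℝ w v))) ((2 * Real.pi)⁻¹ • ξ) := by
    intro ξ
    simp only [hat, compCLMOfContinuousLinearEquiv_apply, Function.comp_apply, dilation_apply,
      real_inner_smul_left]
    congr 3
    field_simp
  simp_rw [h1]
  rw [Measure.integral_comp_smul volume
    (fun w => 𝓕⁻ φ w * phase (-(2 * Real.pi * inner ℝ w v))) ((2 * Real.pi)⁻¹)]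
  have h2 : ∫ w, 𝓕⁻ φ w * phase (-(2 * Real.pi * inner ℝ w v)) = φ v := by
    have h3 : 𝓕 (𝓕⁻ φ : 𝓢(Config d, ℂ)) = φ := FourierInvPair.fourier_fourierInv_eq φ
    conv_rhs => rw [← h3]
    rw [fourier_coe, Real.fourier_eq']
    congr with w
    rw [smul_eq_mul, mul_comm, phase]
    congr 2
    rw [mul_comm]
    push_cast
    ring
  rw [h2, finrank_euclideanSpace, Fintype.card_fin, abs_of_pos (by positivity)]
  rw [Complex.real_smul]
  push_cast
  have : (2 * (Real.pi : ℂ)) ≠ 0 := by simp [Real.pi_ne_zero]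
  rw [← mul_assoc]
  field_simp

lemma hat_surjective (ψ : 𝓢(Config d, ℂ)) : ∃ φ : 𝓢(Config d, ℂ), hat φ = ψ := by
  refine ⟨𝓕 (compCLMOfContinuousLinearEquiv ℂ (dilation d).symm ψ), ?_⟩
  rw [hat, fourierInv_fourier_eq]
  ext x
  change ψ ((dilation d).symm (dilation d x)) = ψ x
  rw [ContinuousLinearEquiv.symm_apply_apply]

/-- Differentiation multiplies the density by i p·v, so derivatives of the test symbols hat φ ⊗ hat
ψ are again of that form. This makes the Poisson bracket computable. -/
lemma exists_fderiv_hat (φ : 𝓢(Config d, ℂ)) (v : Config d) :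
    ∃ χ : 𝓢(Config d, ℂ), (∀ p, χ p = Complex.I * ((inner ℝ p v : ℝ) : ℂ) * φ p) ∧
      ∀ x, fderiv ℝ (hat φ) x v = hat χ x := by
  have hg : (inner ℝ · v : Config d → ℝ).HasTemperateGrowth := by fun_prop
  refine ⟨Complex.I • smulLeftCLM ℂ (inner ℝ · v) φ, fun p => ?_, fun x => ?_⟩
  · simp [smulLeftCLM_apply_apply hg, mul_assoc]
  · rw [← lineDerivOp_apply_eq_fderiv, hat, lineDerivOp_compCLMOfContinuousLinearEquiv, hat,
      lineDerivOp_fourierInv_eq]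
    have e : ((2 * Real.pi * Complex.I) • smulLeftCLM ℂ (inner ℝ · (dilation d v)) φ :
        𝓢(Config d, ℂ)) = Complex.I • smulLeftCLM ℂ (inner ℝ · v) φ := by
      have hg' : (inner ℝ · (dilation d v) : Config d → ℝ).HasTemperateGrowth := by fun_prop
      ext p
      simp only [smul_apply, smulLeftCLM_apply_apply hg, smulLeftCLM_apply_apply hg']
      simp only [dilation_apply, inner_smul_right, Complex.real_smul, smul_eq_mul]
      push_cast
      have : (Real.pi : ℂ) ≠ 0 := by simp [Real.pi_ne_zero]
      field_simp
    rw [e]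

/-! ### Gaussian wave packets -/

lemma pow_mul_exp_neg_sq_le (m : ℕ) {r : ℝ} (hr : 0 ≤ r) :
    (1 + r) ^ m * Real.exp (-(1 / 2) * r ^ 2) ≤ m.factorial * Real.exp (3 / 2) := by
  have h1 : (1 + r) ^ m ≤ m.factorial * Real.exp (1 + r) := by
    have := Real.pow_div_factorial_le_exp (1 + r) (by positivity) m
    rwa [div_le_iff₀ (by positivity), mul_comm] at this
  calc _ ≤ m.factorial * Real.exp (1 + r) * Real.exp (-(1 / 2) * r ^ 2) := by gcongr
    _ = m.factorial * Real.exp (1 + r + -(1 / 2) * r ^ 2) := by rw [mul_assoc, ← Real.exp_add]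
    _ ≤ _ := by
      gcongr
      nlinarith [sq_nonneg (r - 1)]

/-- The real Gaussian `exp (-|x|²/2)` as a Schwartz function. -/
def realGaussian (d : ℕ) : 𝓢(Config d, ℝ) where
  toFun x := Real.exp (-(1 / 2) * ‖x‖ ^ 2)
  smooth' := Real.contDiff_exp.comp (contDiff_const.mul (contDiff_norm_sq ℝ))
  decay' k n := by
    have hq : (fun x : Config d => -(1 / 2) * ‖x‖ ^ 2).HasTemperateGrowth :=
      (Function.HasTemperateGrowth.const (-(1 / 2) : ℝ)).mul
        (Function.hasTemperateGrowth_norm_sq (Config d))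
    obtain ⟨l, C, hC, h⟩ := hq.norm_iteratedFDeriv_le_uniform n
    refine ⟨n.factorial * (C + 1) ^ n * ((k + l * n).factorial * Real.exp (3 / 2)), fun x => ?_⟩
    have hle := norm_iteratedFDeriv_comp_le (𝕜 := ℝ) (g := Real.exp)
      (f := fun x : Config d => -(1 / 2) * ‖x‖ ^ 2) (n := n) (N := ∞) Real.contDiff_exp hq.1
      -- The `C + 1` makes D ≥ 1, so that D ≤ D^i for i ≥ 1, as the Faà di Bruno bound requires.
      (mod_cast le_top) x (C := Real.exp (-(1 / 2) * ‖x‖ ^ 2)) (D := (C + 1) * (1 + ‖x‖) ^ l)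
      (fun i _ => by
        rw [norm_iteratedFDeriv_eq_norm_iteratedDeriv, iteratedDeriv_eq_iterate,
          Real.iter_deriv_exp, Real.norm_eq_abs, Real.abs_exp])
      (fun i hi hin => by
        refine (h i hin x).trans ?_
        have h1 : (1 : ℝ) ≤ (C + 1) * (1 + ‖x‖) ^ l := by
          have : (1 : ℝ) ≤ (1 + ‖x‖) ^ l := one_le_pow₀ (by linarith [norm_nonneg x])
          nlinarith
        refine le_trans ?_ (le_self_pow₀ h1 (by lia))
        gcongr
        linarith)
    calc _ ≤ (1 + ‖x‖) ^ k * (n.factorial * Real.exp (-(1 / 2) * ‖x‖ ^ 2) *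
          ((C + 1) * (1 + ‖x‖) ^ l) ^ n) := by
          gcongr
          · linarith
          · exact hle
      _ = n.factorial * (C + 1) ^ n * ((1 + ‖x‖) ^ (k + l * n) *
          Real.exp (-(1 / 2) * ‖x‖ ^ 2)) := by
          rw [mul_pow, ← pow_mul, pow_add]; ring
      _ ≤ _ := by
          exact mul_le_mul_of_nonneg_left (pow_mul_exp_neg_sq_le _ (norm_nonneg x))
            (by positivity)

lemma hasTemperateGrowth_phase_inner (t : Config d) :
    (fun x : Config d => phase (inner ℝ t x)).HasTemperateGrowth := by
  have h : phase.HasTemperateGrowth := by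
    refine ⟨(contDiff_const.mul Complex.ofRealCLM.contDiff).cexp, fun n => ⟨0, 1, fun s => ?_⟩⟩
    rw [norm_iteratedFDeriv_eq_norm_iteratedDeriv]
    have : iteratedDeriv n phase s = Complex.I ^ n * phase s := by
      induction n generalizing s with
      | zero => simp
      | succ n ih =>
        rw [iteratedDeriv_succ, funext ih]
        have : HasDerivAt phase (Complex.I * phase s) s := by
          unfold phase
          have h1 : HasDerivAt (fun s : ℝ => Complex.I * (s : ℂ)) Complex.I s := by
            simpa using (Complex.ofRealCLM.hasDerivAt (x := s)).const_mul Complex.I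
          rw [mul_comm]
          exact h1.cexp
        rw [(this.const_mul _).deriv]
        ring
    rw [this]
    simp
  exact h.comp (f := fun x : Config d => inner ℝ t x) (by fun_prop)

/-- The wave packet `exp (-|x - a|²/2) e^{i t·x}`. -/
def wavePacket (a t : Config d) : 𝓢(Config d, ℂ) :=
  smulLeftCLM ℂ (fun x => phase (inner ℝ t x))
    (compSubConstCLM ℝ a (postcompCLM Complex.ofRealCLM (realGaussian d)))

lemma wavePacket_apply (a t x : Config d) :
    wavePacket a t x = phase (inner ℝ t x) * (Real.exp (-(1 / 2) * ‖x - a‖ ^ 2) : ℝ) := by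
  rw [wavePacket, smulLeftCLM_apply_apply (hasTemperateGrowth_phase_inner t)]
  rfl

/-! ### Symbols -/

/-- Derivatives up to order `b + d + 1` have growth of order `b` only. -/
def IsTame (b : ℕ) (B : Phase d → ℂ) : Prop :=
  ContDiff ℝ ∞ B ∧ ∃ C : ℝ, 0 ≤ C ∧ ∀ k ≤ b + d + 1, ∀ X : Phase d,
    ‖iteratedFDeriv ℝ k B X‖ ≤ C * ((1 + ‖X.1‖) * (1 + ‖X.2‖)) ^ b

lemma one_le_japaneseBracket (X : Phase d) : 1 ≤ japaneseBracket X := by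
  rw [japaneseBracket, Real.one_le_sqrt]
  nlinarith [sq_nonneg ‖X.1‖, sq_nonneg ‖X.2‖]

lemma japaneseBracket_le (X : Phase d) : japaneseBracket X ≤ (1 + ‖X.1‖) * (1 + ‖X.2‖) := by
  rw [japaneseBracket, Real.sqrt_le_left (by positivity)]
  have := norm_nonneg X.1
  have := norm_nonneg X.2
  nlinarith [mul_nonneg (norm_nonneg X.1) (norm_nonneg X.2), sq_nonneg (‖X.1‖ * ‖X.2‖),
    mul_nonneg (mul_nonneg (norm_nonneg X.1) (norm_nonneg X.2)) (norm_nonneg X.1),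
    mul_nonneg (mul_nonneg (norm_nonneg X.1) (norm_nonneg X.2)) (norm_nonneg X.2)]

/-- Each derivative costs at most ρ = max(δ, 0) < 1 in growth, so b + d + 1 of them cost less than b
once b is large. -/
lemma IsSymbol.exists_isTame {μ δ : ℝ} (hδ : δ < 1) {B : Phase d → ℂ} (hB : IsSymbol μ δ B) :
    ∃ b, IsTame b B := by
  obtain ⟨hsm, hbd⟩ := hB
  choose C hC using hbd
  set ρ := max δ 0
  have hρ : ρ < 1 := max_lt hδ one_pos
  have hρ0 : 0 ≤ ρ := le_max_right _ _
  obtain ⟨b, hb⟩ := exists_nat_ge ((|μ| + d + 1) / (1 - ρ))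
  have hb' : |μ| + ρ * (b + d + 1 : ℕ) ≤ b := by
    rw [div_le_iff₀ (by linarith)] at hb
    push_cast
    have : (0 : ℝ) ≤ d := by positivity
    nlinarith
  refine ⟨b, hsm, ∑ k ∈ Finset.range (b + d + 2), |C k|, by positivity, fun k hk X => ?_⟩
  have hle : μ + δ * k ≤ b := by
    refine le_trans ?_ hb'
    have : (k : ℝ) ≤ (b + d + 1 : ℕ) := by exact_mod_cast hk
    have h3 : δ * k ≤ ρ * k := by gcongr; exact le_max_left _ _
    have h4 : ρ * k ≤ ρ * (b + d + 1 : ℕ) := by gcongr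
    linarith [le_abs_self μ]
  have h1 := one_le_japaneseBracket X
  calc _ ≤ C k * japaneseBracket X ^ (μ + δ * k) := hC k X
    _ ≤ |C k| * japaneseBracket X ^ (b : ℝ) := by
      gcongr
      · exact le_abs_self _
    _ = |C k| * japaneseBracket X ^ b := by rw [Real.rpow_natCast]
    _ ≤ _ := by
      gcongr
      · exact Finset.single_le_sum (f := fun k => |C k|) (fun _ _ => abs_nonneg _)
          (Finset.mem_range.2 (by lia))
      · exact japaneseBracket_le X

lemma IsSymbol.fderiv_apply {μ δ : ℝ} {B : Phase d → ℂ} (hB : IsSymbol μ δ B) (v : Phase d) :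
    IsSymbol (μ + δ) δ fun X => fderiv ℝ B X v := by
  obtain ⟨hsm, hbd⟩ := hB
  have hsm' : ContDiff ℝ ∞ (fderiv ℝ B) := hsm.fderiv_right (by simp)
  refine ⟨hsm'.clm_apply contDiff_const, fun n => ?_⟩
  obtain ⟨C, hC⟩ := hbd (n + 1)
  refine ⟨‖v‖ * C, fun X => ?_⟩
  have h1 := norm_iteratedFDeriv_clm_apply_const (𝕜 := ℝ) (f := fderiv ℝ B) (c := v) (x := X)
    (N := ∞) (n := n) hsm'.contDiffAt (mod_cast le_top)
  refine h1.trans ?_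
  rw [norm_iteratedFDeriv_fderiv, mul_assoc]
  gcongr
  have e : μ + δ + δ * n = μ + δ * (n + 1 : ℕ) := by push_cast; ring
  rw [e]
  exact hC X

/-! ### The inner integral of the Weyl quantization -/

/-- `∫ B((x + y)/2, ξ) e^{-i η·y} f(y) dy`. -/
def innerIntegral (B : Phase d → ℂ) (f : Config d → ℂ) (x ξ η : Config d) : ℂ :=
  ∫ y, B ((1 / 2 : ℝ) • (x + y), ξ) * phase (-inner ℝ η y) * f y

lemma norm_iteratedFDeriv_comp_midpoint_le {B : Phase d → ℂ} (hB : ContDiff ℝ ∞ B)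
    (x ξ y : Config d) (n : ℕ) :
    ‖iteratedFDeriv ℝ n (fun y => B ((1 / 2 : ℝ) • (x + y), ξ)) y‖ ≤
      ‖iteratedFDeriv ℝ n B ((1 / 2 : ℝ) • (x + y), ξ)‖ := by
  -- The midpoint map is affine in y with linear part y ↦ (y/2, 0), of norm at most 1.
  set L : Config d →L[ℝ] Phase d := ((1 / 2 : ℝ) • ContinuousLinearMap.id ℝ (Config d)).prod 0
  have hL : ‖L‖ ≤ 1 := by
    refine ContinuousLinearMap.opNorm_le_bound _ zero_le_one fun y => ?_
    simp only [L, ContinuousLinearMap.prod_apply, Prod.norm_def]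
    simp [norm_smul]
    linarith [norm_nonneg y]
  set a : Phase d := ((1 / 2 : ℝ) • x, ξ)
  have hLy : ∀ y, a + L y = ((1 / 2 : ℝ) • (x + y), ξ) := fun y => by simp [a, L]
  have e : (fun y => B ((1 / 2 : ℝ) • (x + y), ξ)) = (fun z => B (a + z)) ∘ L := by
    ext y; simp only [← hLy, Function.comp_apply]
  have h2 : ContDiff ℝ ∞ fun z => B (a + z) := hB.comp (by fun_prop)
  rw [e, L.iteratedFDeriv_comp_right h2 y (i := n) (mod_cast le_top)]
  refine (ContinuousMultilinearMap.norm_compContinuousLinearMap_le _ _).trans ?_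
  simp only [Finset.prod_const, Finset.card_univ, Fintype.card_fin]
  rw [iteratedFDeriv_comp_add_left, hLy]
  exact mul_le_of_le_one_right (norm_nonneg _) (pow_le_one₀ (norm_nonneg _) hL)

lemma one_add_norm_midpoint_le (x y : Config d) :
    1 + ‖(1 / 2 : ℝ) • (x + y)‖ ≤ (1 + ‖x‖) * (1 + ‖y‖) := by
  refine le_trans ?_ (one_add_norm_add_le x y)
  rw [norm_smul]
  norm_num
  linarith [norm_nonneg (x + y)]

/-- Leibniz rule; the growth (1 + |y|)^b that the midpoint contributes is absorbed by the decay of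
f. -/
lemma IsTame.integrand_bound {b : ℕ} {B : Phase d → ℂ} (hB : IsTame b B) (f : 𝓢(Config d, ℂ)) :
    ∃ C : ℝ, 0 ≤ C ∧ ∀ n ≤ b + d + 1, ∀ x ξ y : Config d,
      ‖iteratedFDeriv ℝ n (fun y => B ((1 / 2 : ℝ) • (x + y), ξ) * f y) y‖ ≤
        C * ((1 + ‖x‖) * (1 + ‖ξ‖)) ^ b * decayWeight y := by
  obtain ⟨hsm, C, hC, h⟩ := hB
  choose C' hC' h' using fun n => SchwartzMap.exists_norm_le_decayWeight f b n
  set S := ∑ i ∈ Finset.range (b + d + 2), C' i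
  have hS : 0 ≤ S := Finset.sum_nonneg fun i _ => hC' i
  refine ⟨2 ^ (b + d + 1) * C * S, by positivity, fun n hn x ξ y => ?_⟩
  have h1 : ContDiff ℝ ∞ fun y => B ((1 / 2 : ℝ) • (x + y), ξ) := hsm.comp (by fun_prop)
  refine (norm_iteratedFDeriv_mul_le h1 (f.smooth ⊤) y (n := n) (mod_cast le_top)).trans ?_
  have key : ∀ i ∈ Finset.range (n + 1), (n.choose i : ℝ) *
      ‖iteratedFDeriv ℝ i (fun y => B ((1 / 2 : ℝ) • (x + y), ξ)) y‖ *
        ‖iteratedFDeriv ℝ (n - i) f y‖ ≤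
      n.choose i * (C * S * ((1 + ‖x‖) * (1 + ‖ξ‖)) ^ b * decayWeight y) := by
    intro i hi
    have hi' : i ≤ n := by simpa [Nat.lt_succ_iff] using hi
    rw [mul_assoc]
    refine mul_le_mul_of_nonneg_left ?_ (by positivity)
    calc _ ≤ (C * (((1 + ‖x‖) * (1 + ‖y‖)) * (1 + ‖ξ‖)) ^ b) *
          ‖iteratedFDeriv ℝ (n - i) f y‖ := by
          gcongr
          refine (norm_iteratedFDeriv_comp_midpoint_le hsm x ξ y i).trans ?_
          refine (h i (hi'.trans hn) _).trans ?_
          gcongr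
          exact one_add_norm_midpoint_le x y
      _ = C * ((1 + ‖x‖) * (1 + ‖ξ‖)) ^ b *
          ((1 + ‖y‖) ^ b * ‖iteratedFDeriv ℝ (n - i) f y‖) := by
          simp only [mul_pow]; ring
      _ ≤ C * ((1 + ‖x‖) * (1 + ‖ξ‖)) ^ b * (S * decayWeight y) := by
          refine mul_le_mul_of_nonneg_left ((h' (n - i) y).trans ?_) (by positivity)
          refine mul_le_mul_of_nonneg_right ?_ (decayWeight_pos y).le
          · exact Finset.single_le_sum (f := C') (fun i _ => hC' i)
              (Finset.mem_range.2 (by lia))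
      _ = _ := by ring
  refine (Finset.sum_le_sum key).trans ?_
  rw [← Finset.sum_mul, ← Nat.cast_sum, Nat.sum_range_choose]
  have : ((2 ^ n : ℕ) : ℝ) ≤ 2 ^ (b + d + 1) := by
    push_cast
    exact pow_le_pow_right₀ one_le_two hn
  calc _ ≤ 2 ^ (b + d + 1) * (C * S * ((1 + ‖x‖) * (1 + ‖ξ‖)) ^ b * decayWeight y) := by
        gcongr
        have := (decayWeight_pos y).le
        positivity
    _ = _ := by ring

lemma innerIntegral_eq_fourier (B : Phase d → ℂ) (f : Config d → ℂ) (x ξ η : Config d) :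
    innerIntegral B f x ξ η =
      𝓕 (fun y => B ((1 / 2 : ℝ) • (x + y), ξ) * f y) ((2 * Real.pi)⁻¹ • η) := by
  rw [innerIntegral, Real.fourier_eq']
  congr with y
  rw [smul_eq_mul, mul_right_comm, mul_comm, phase]
  congr 2
  rw [mul_comm, inner_smul_right, real_inner_comm]
  congr 2
  field_simp

lemma one_add_pow_le {r : ℝ} (hr : 0 ≤ r) (n : ℕ) : (1 + r) ^ n ≤ 2 ^ n * (1 + r ^ n) := by
  rcases le_total r 1 with h | h
  · calc (1 + r) ^ n ≤ 2 ^ n := by gcongr; linarith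
      _ ≤ _ := by nlinarith [pow_nonneg hr n, pow_pos (two_pos (α := ℝ)) n]
  · calc (1 + r) ^ n ≤ (2 * r) ^ n := by gcongr; linarith
      _ ≤ _ := by rw [mul_pow]; nlinarith [pow_nonneg hr n, pow_pos (two_pos (α := ℝ)) n]

/-- Integration by parts b + d + 1 times. When η is comparable to ξ, the growth of order b in ξ is
beaten and an integrable decay of order d + 1 remains. -/
lemma IsTame.innerIntegral_bound {b : ℕ} {B : Phase d → ℂ} (hB : IsTame b B)
    (f : 𝓢(Config d, ℂ)) :
    ∃ C : ℝ, 0 ≤ C ∧ ∀ x ξ η : Config d,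
      (1 + ‖η‖) ^ (b + d + 1) * ‖innerIntegral B f x ξ η‖ ≤
        C * ((1 + ‖x‖) * (1 + ‖ξ‖)) ^ b := by
  obtain ⟨C, hC, h⟩ := hB.integrand_bound f
  set N := b + d + 1 with hN
  set I := ∫ y : Config d, decayWeight y
  have hI : 0 ≤ I := integral_nonneg fun y => (decayWeight_pos y).le
  refine ⟨2 ^ N * (1 + (2 * Real.pi) ^ N) * (2 ^ N * ((N + 1) * (C * I))), by positivity,
    fun x ξ η => ?_⟩
  set G : Config d → ℂ := fun y => B ((1 / 2 : ℝ) • (x + y), ξ) * f y with hG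
  set W := ((1 + ‖x‖) * (1 + ‖ξ‖)) ^ b
  have hGs : ContDiff ℝ ∞ G := (hB.1.comp (by fun_prop)).mul (f.smooth ⊤)
  have hint : ∀ n ≤ N, Integrable (fun y => ‖iteratedFDeriv ℝ n G y‖) := by
    intro n hn
    refine (integrable_decayWeight.const_mul (C * W)).mono' ?_ ?_
    · exact (hGs.continuous_iteratedFDeriv (m := n) (mod_cast le_top)).norm.aestronglyMeasurable
    · exact Filter.Eventually.of_forall fun y => (norm_norm _).trans_le (h n hn x ξ y)
  have hle : ∀ n ≤ N, ∫ y, ‖iteratedFDeriv ℝ n G y‖ ≤ C * I * W := by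
    intro n hn
    calc _ ≤ ∫ y, C * W * decayWeight y :=
          integral_mono (hint n hn) (integrable_decayWeight.const_mul _) (h n hn x ξ)
      _ = _ := by rw [integral_const_mul]; ring
  set w := (2 * Real.pi)⁻¹ • η
  have hbd : ∀ n ≤ N, ‖w‖ ^ n * ‖𝓕 G w‖ ≤ 2 ^ N * ((N + 1) * (C * I)) * W := by
    intro n hn
    -- `K := 0`: only decay of the Fourier transform is wanted, not its derivatives, so no moments
    -- in y enter.
    have := Real.pow_mul_norm_iteratedFDeriv_fourier_le (K := 0) (N := (N : ℕ)) (f := G)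
      (hGs.of_le (mod_cast le_top)) (fun k m hk hm => by
        have hk0 : k = 0 := by simpa using hk
        subst hk0
        simpa using hint m (by exact_mod_cast hm)) (k := 0) (n := n) le_rfl (by exact_mod_cast hn) w
    simp only [norm_iteratedFDeriv_zero, pow_zero, one_mul, CharP.cast_eq_zero, mul_zero, zero_add,
      Finset.range_one, Finset.sum_product, Finset.sum_singleton] at this
    refine this.trans ?_
    calc _ ≤ 2 ^ N * ∑ m ∈ Finset.range (n + 1), C * I * W := by
          have hnn : 0 ≤ ∑ m ∈ Finset.range (n + 1), ∫ y, ‖iteratedFDeriv ℝ m G y‖ :=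
            Finset.sum_nonneg fun m _ => integral_nonneg fun y => norm_nonneg _
          gcongr with m hm
          · exact one_le_two
          · exact hle m (by simp at hm; lia)
      _ ≤ 2 ^ N * ∑ m ∈ Finset.range (N + 1), C * I * W := by
          gcongr
      _ = _ := by
          rw [Finset.sum_const, Finset.card_range, nsmul_eq_mul]; push_cast; ring
  rw [innerIntegral_eq_fourier]
  have hη : ‖η‖ = 2 * Real.pi * ‖w‖ := by
    rw [norm_smul, Real.norm_eq_abs, abs_of_pos (by positivity)]
    field_simp
  calc (1 + ‖η‖) ^ N * ‖𝓕 G w‖ ≤ 2 ^ N * (1 + ‖η‖ ^ N) * ‖𝓕 G w‖ := by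
        gcongr
        exact one_add_pow_le (norm_nonneg _) _
    _ = 2 ^ N * (‖w‖ ^ 0 * ‖𝓕 G w‖ + (2 * Real.pi) ^ N * (‖w‖ ^ N * ‖𝓕 G w‖)) := by
        rw [hη, mul_pow]; ring
    _ ≤ 2 ^ N * (2 ^ N * ((N + 1) * (C * I)) * W +
          (2 * Real.pi) ^ N * (2 ^ N * ((N + 1) * (C * I)) * W)) := by
        gcongr 2 ^ N * (?_ + (2 * Real.pi) ^ N * ?_)
        · exact hbd 0 (by lia)
        · exact hbd N le_rfl
    _ = _ := by ring

lemma IsTame.continuous_innerIntegral {b : ℕ} {B : Phase d → ℂ} (hB : IsTame b B)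
    (f : 𝓢(Config d, ℂ)) :
    Continuous fun v : Config d × Config d × Config d => innerIntegral B f v.1 v.2.1 v.2.2 := by
  obtain ⟨C, hC, h⟩ := hB.integrand_bound f
  have hBc := hB.1.continuous
  have hfc := f.continuous
  rw [continuous_iff_continuousAt]
  intro v₀
  have hev : ∀ᶠ v : Config d × Config d × Config d in nhds v₀,
      C * ((1 + ‖v.1‖) * (1 + ‖v.2.1‖)) ^ b < C * ((1 + ‖v₀.1‖) * (1 + ‖v₀.2.1‖)) ^ b + 1 := by
    refine (ContinuousAt.eventually_lt (f := fun v : Config d × Config d × Config d =>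
      C * ((1 + ‖v.1‖) * (1 + ‖v.2.1‖)) ^ b) ?_ continuousAt_const (by simp))
    fun_prop
  refine continuousAt_of_dominated
    (bound := fun y => (C * ((1 + ‖v₀.1‖) * (1 + ‖v₀.2.1‖)) ^ b + 1) * decayWeight y)
    (Filter.Eventually.of_forall fun v => ?_) ?_ (integrable_decayWeight.const_mul _)
    (Filter.Eventually.of_forall fun y => ?_)
  · exact Continuous.aestronglyMeasurable (by fun_prop)
  · filter_upwards [hev] with v hv
    refine Filter.Eventually.of_forall fun y => ?_
    have h0 := h 0 (by lia) v.1 v.2.1 y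
    rw [norm_iteratedFDeriv_zero] at h0
    rw [mul_right_comm, norm_mul, norm_phase, mul_one]
    refine h0.trans ?_
    have := (decayWeight_pos y).le
    gcongr
  · exact Continuous.continuousAt (by fun_prop)

/-! ### Weighted Fubini theorems -/

lemma integrable_pow_mul_schwartz (φ : 𝓢(Config d, ℂ)) (a : ℕ) :
    Integrable fun p => (1 + ‖p‖) ^ a * ‖φ p‖ := by
  obtain ⟨C, -, h⟩ := SchwartzMap.exists_norm_le_decayWeight φ a 0
  refine (integrable_decayWeight.const_mul C).mono' ?_ ?_
  · have := φ.continuous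
    exact Continuous.aestronglyMeasurable (by fun_prop)
  · refine Filter.Eventually.of_forall fun p => ?_
    rw [Real.norm_of_nonneg (by positivity)]
    simpa using h p

/-- The integrable weight `(1 + |p|)^a |φ(p)| (1 + |q|)^a |ψ(q)|`. -/
def tensorWeight (φ ψ : 𝓢(Config d, ℂ)) (a : ℕ) (z : Phase d) : ℝ :=
  ((1 + ‖z.1‖) ^ a * ‖φ z.1‖) * ((1 + ‖z.2‖) ^ a * ‖ψ z.2‖)

lemma integrable_tensorWeight (φ ψ : 𝓢(Config d, ℂ)) (a : ℕ) :
    Integrable (tensorWeight φ ψ a) :=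
  (integrable_pow_mul_schwartz φ a).mul_prod (integrable_pow_mul_schwartz ψ a)

lemma norm_tensor_mul_le (φ ψ : 𝓢(Config d, ℂ)) {a : ℕ} {C : ℝ} {z : Phase d} {w : ℂ}
    (h : ‖w‖ ≤ C * ((1 + ‖z.1‖) * (1 + ‖z.2‖)) ^ a) :
    ‖φ z.1 * ψ z.2 * w‖ ≤ C * tensorWeight φ ψ a z := by
  rw [norm_mul, norm_mul]
  calc _ ≤ ‖φ z.1‖ * ‖ψ z.2‖ * (C * ((1 + ‖z.1‖) * (1 + ‖z.2‖)) ^ a) := by gcongr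
    _ = _ := by rw [tensorWeight, mul_pow]; ring

lemma integrable_tensor_mul (φ ψ : 𝓢(Config d, ℂ)) {R : Phase d → ℂ} (hR : Continuous R) {a : ℕ}
    {C : ℝ} (h : ∀ p q, ‖R (p, q)‖ ≤ C * ((1 + ‖p‖) * (1 + ‖q‖)) ^ a) :
    Integrable fun z : Phase d => φ z.1 * ψ z.2 * R z := by
  have := φ.continuous
  have := ψ.continuous
  refine ((integrable_tensorWeight φ ψ a).const_mul C).mono' ?_ ?_
  · exact Continuous.aestronglyMeasurable (by fun_prop)
  · exact Filter.Eventually.of_forall fun z => norm_tensor_mul_le φ ψ (h z.1 z.2)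

lemma integral_tensor_mul_comm (φ ψ : 𝓢(Config d, ℂ)) {Ψ : Phase d → Config d → ℂ}
    (hΨ : Continuous fun v : Phase d × Config d => Ψ v.1 v.2) {a : ℕ} {C : ℝ}
    (h : ∀ p q y, ‖Ψ (p, q) y‖ ≤ C * ((1 + ‖p‖) * (1 + ‖q‖)) ^ a * decayWeight y) :
    ∫ y, ∫ z : Phase d, φ z.1 * ψ z.2 * Ψ z y = ∫ z : Phase d, φ z.1 * ψ z.2 * ∫ y, Ψ z y := by
  simp_rw [← integral_const_mul]
  refine integral_integral_swap ?_
  have := φ.continuous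
  have := ψ.continuous
  refine (((integrable_decayWeight (d := d)).mul_prod
    ((integrable_tensorWeight φ ψ a).const_mul C))).mono' ?_ ?_
  · have hΨ' : Continuous fun v : Config d × Phase d => Ψ v.2 v.1 :=
      hΨ.comp (continuous_snd.prodMk continuous_fst)
    exact Continuous.aestronglyMeasurable (by simp only [Function.uncurry_def]; fun_prop)
  · refine Filter.Eventually.of_forall fun v => ?_
    have := norm_tensor_mul_le φ ψ (C := C * decayWeight v.1) (a := a) (z := v.2) (w := Ψ v.2 v.1)
      ((h v.2.1 v.2.2 v.1).trans_eq (by ring))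
    exact this.trans_eq (by ring)

/-- The integrand need not be absolutely integrable in (ξ, y) jointly. The z-integral is therefore
exchanged first with y at fixed ξ, with constants depending on ξ, and then with ξ, using the decay
of the computed y-integral. -/
lemma integral_integral_tensor_mul_comm (φ ψ : 𝓢(Config d, ℂ))
    {Θ : Phase d → Config d → Config d → ℂ}
    (hΘ : ∀ ξ, Continuous fun v : Phase d × Config d => Θ v.1 ξ v.2)
    (hb : ∀ ξ, ∃ (a : ℕ) (C : ℝ), ∀ p q y,
      ‖Θ (p, q) ξ y‖ ≤ C * ((1 + ‖p‖) * (1 + ‖q‖)) ^ a * decayWeight y)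
    (hI : Continuous fun v : Phase d × Config d => ∫ y, Θ v.1 v.2 y)
    (hIb : ∃ (a : ℕ) (C : ℝ), ∀ p q ξ,
      ‖∫ y, Θ (p, q) ξ y‖ ≤ C * ((1 + ‖p‖) * (1 + ‖q‖)) ^ a * decayWeight ξ) :
    ∫ ξ, ∫ y, ∫ z : Phase d, φ z.1 * ψ z.2 * Θ z ξ y =
      ∫ z : Phase d, φ z.1 * ψ z.2 * ∫ ξ, ∫ y, Θ z ξ y := by
  obtain ⟨a, C, h⟩ := hIb
  rw [← integral_tensor_mul_comm φ ψ hI h]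
  congr with ξ
  obtain ⟨a, C, h⟩ := hb ξ
  exact integral_tensor_mul_comm φ ψ (hΘ ξ) h

/-! ### The Weyl quantization of `e^{i(p·x + q·ξ)} B(x + λq, ξ - λp)` -/

/-- The normalization constant `(2π)^{-d}`. -/
def weylConst (d : ℕ) : ℂ := ((2 * Real.pi : ℝ) : ℂ)⁻¹ ^ d

lemma weylConst_ne_zero (d : ℕ) : weylConst d ≠ 0 := by
  have : (2 * Real.pi : ℝ) ≠ 0 := by positivity
  exact pow_ne_zero _ (inv_ne_zero (by exact_mod_cast this))

/-- The inner integral of the Weyl quantization of `e^{i(p·x + q·ξ)} B(x + sq, ξ - sp)`. -/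
def weylInner (B : Phase d → ℂ) (f : Config d → ℂ) (s : ℝ) (p q x ξ : Config d) : ℂ :=
  phase (inner ℝ p x / 2 + inner ℝ q ξ + inner ℝ ξ x) *
    innerIntegral B f (x + (2 * s) • q) (ξ - s • p) (ξ - (1 / 2 : ℝ) • p)

/-- `(2π)^d` times the Weyl quantization of `e^{i(p·x + q·ξ)} B(x + sq, ξ - sp)`. -/
def weylAvg (B : Phase d → ℂ) (f : Config d → ℂ) (s : ℝ) (x : Config d) (z : Phase d) : ℂ :=
  ∫ ξ, weylInner B f s z.1 z.2 x ξ

/-- The shift 2sq of x becomes sq at the midpoint, and half of the phase p·(x + y)/2 moves the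
frequency in y to ξ - p/2. -/
lemma weylInner_eq (B : Phase d → ℂ) (f : Config d → ℂ) (s : ℝ) (p q x ξ : Config d) :
    weylInner B f s p q x ξ =
      ∫ y, phase (inner ℝ p ((1 / 2 : ℝ) • (x + y))) * phase (inner ℝ q ξ) *
        B ((1 / 2 : ℝ) • (x + y) + s • q, ξ - s • p) * phase (inner ℝ ξ (x - y)) * f y := by
  rw [weylInner, innerIntegral, ← integral_const_mul]
  congr with y
  have e : (1 / 2 : ℝ) • (x + (2 * s) • q + y) = (1 / 2 : ℝ) • (x + y) + s • q := by
    module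
  rw [e]
  have e2 : phase (inner ℝ p x / 2 + inner ℝ q ξ + inner ℝ ξ x) *
      phase (-inner ℝ (ξ - (1 / 2 : ℝ) • p) y) =
      phase (inner ℝ p ((1 / 2 : ℝ) • (x + y))) * phase (inner ℝ q ξ) *
        phase (inner ℝ ξ (x - y)) := by
    simp only [← phase_add]
    congr 1
    simp only [inner_sub_left, inner_sub_right, inner_add_right, inner_smul_left, inner_smul_right]
    simp
    ring
  linear_combination (B ((1 / 2 : ℝ) • (x + y) + s • q, ξ - s • p) * f y) * e2

lemma weylOp_eq (B : Phase d → ℂ) (f : Config d → ℂ) (x : Config d) :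
    weylOp B f x = weylConst d * weylAvg B f 0 x 0 := by
  rw [weylOp, weylConst, weylAvg]
  congr with ξ
  rw [weylInner_eq]
  congr with y
  simp [phase]

lemma weylOp_eq' (B : Phase d → ℂ) (f : Config d → ℂ) (x : Config d) :
    weylOp B f x = weylConst d *
      ∫ ξ, ∫ y, B ((1 / 2 : ℝ) • (x + y), ξ) * phase (inner ℝ ξ (x - y)) * f y := rfl

variable {b : ℕ} {B : Phase d → ℂ}

/-- Peetre's inequality compares the weights at ξ - βp and ξ - γp with the weight at ξ, at the price
of powers of 1 + |p|: b from the first and b + d + 1 from the second, hence the exponent 2b + d + 1.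
-/
lemma IsTame.innerIntegral_shift_bound (hB : IsTame b B) (f : 𝓢(Config d, ℂ)) (α β γ : ℝ) :
    ∃ (a : ℕ) (C : ℝ), 0 ≤ C ∧ ∀ p q x ξ : Config d,
      ‖innerIntegral B f (x + α • q) (ξ - β • p) (ξ - γ • p)‖ ≤
        C * ((1 + ‖p‖) * (1 + ‖q‖) * (1 + ‖x‖)) ^ a * decayWeight ξ := by
  obtain ⟨C, hC, h⟩ := hB.innerIntegral_bound f
  refine ⟨2 * b + d + 1, C * (1 + |α|) ^ b * (1 + |β|) ^ b * (1 + |γ|) ^ (b + d + 1),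
    by positivity, fun p q x ξ => ?_⟩
  have hξ : 1 + ‖ξ‖ ≤ (1 + ‖ξ - γ • p‖) * ((1 + |γ|) * (1 + ‖p‖)) := by
    calc 1 + ‖ξ‖ = 1 + ‖(ξ - γ • p) + γ • p‖ := by simp
      _ ≤ (1 + ‖ξ - γ • p‖) * (1 + ‖γ • p‖) := one_add_norm_add_le _ _
      _ ≤ _ := by gcongr; exact one_add_norm_smul_le _ _
  have hξ2 : 1 + ‖ξ - β • p‖ ≤ (1 + ‖ξ‖) * ((1 + |β|) * (1 + ‖p‖)) := by
    rw [sub_eq_add_neg, ← neg_smul]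
    refine (one_add_norm_add_le _ _).trans ?_
    gcongr
    simpa using one_add_norm_smul_le (-β) p
  have hx : 1 + ‖x + α • q‖ ≤ (1 + ‖x‖) * ((1 + |α|) * (1 + ‖q‖)) := by
    refine (one_add_norm_add_le _ _).trans ?_
    gcongr
    exact one_add_norm_smul_le _ _
  set J := ‖innerIntegral B f (x + α • q) (ξ - β • p) (ξ - γ • p)‖ with hJ
  have h1 : (1 + ‖ξ‖) ^ (b + d + 1) * J ≤ ((1 + |γ|) * (1 + ‖p‖)) ^ (b + d + 1) *
      (C * ((1 + ‖x + α • q‖) * (1 + ‖ξ - β • p‖)) ^ b) := by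
    calc _ ≤ ((1 + ‖ξ - γ • p‖) * ((1 + |γ|) * (1 + ‖p‖))) ^ (b + d + 1) * J := by gcongr
      _ = ((1 + |γ|) * (1 + ‖p‖)) ^ (b + d + 1) * ((1 + ‖ξ - γ • p‖) ^ (b + d + 1) * J) := by
        simp only [mul_pow]; ring
      _ ≤ _ := by
        refine mul_le_mul_of_nonneg_left (h _ _ _) (by positivity)
  have h2 : (1 + ‖ξ‖) ^ b * ((1 + ‖ξ‖) ^ (d + 1) * J) ≤ (1 + ‖ξ‖) ^ b *
      (C * (1 + |α|) ^ b * (1 + |β|) ^ b * (1 + |γ|) ^ (b + d + 1) *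
        ((1 + ‖p‖) ^ (2 * b + d + 1) * (1 + ‖q‖) ^ b * (1 + ‖x‖) ^ b)) := by
    calc _ = (1 + ‖ξ‖) ^ (b + d + 1) * J := by ring
      _ ≤ _ := h1
      _ ≤ ((1 + |γ|) * (1 + ‖p‖)) ^ (b + d + 1) * (C * (((1 + ‖x‖) * ((1 + |α|) * (1 + ‖q‖))) *
          ((1 + ‖ξ‖) * ((1 + |β|) * (1 + ‖p‖)))) ^ b) := by gcongr
      _ = _ := by simp only [mul_pow]; ring
  -- Cancelling (1 + |ξ|)^b leaves exactly the decay of order d + 1.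
  have h3 := le_of_mul_le_mul_left h2 (by positivity)
  rw [decayWeight, ← div_eq_mul_inv, le_div_iff₀ (by positivity), mul_comm]
  refine h3.trans ?_
  have hq1 : 1 ≤ 1 + ‖q‖ := by linarith [norm_nonneg q]
  have hx1 : 1 ≤ 1 + ‖x‖ := by linarith [norm_nonneg x]
  rw [mul_pow, mul_pow]
  gcongr <;> first | assumption | lia

lemma IsTame.weylInner_bound (hB : IsTame b B) (f : 𝓢(Config d, ℂ)) (s : ℝ) :
    ∃ (a : ℕ) (C : ℝ), 0 ≤ C ∧ ∀ p q x ξ : Config d, ‖weylInner B f s p q x ξ‖ ≤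
      C * ((1 + ‖p‖) * (1 + ‖q‖) * (1 + ‖x‖)) ^ a * decayWeight ξ := by
  obtain ⟨a, C, hC, h⟩ := hB.innerIntegral_shift_bound f (2 * s) s (1 / 2)
  refine ⟨a, C, hC, fun p q x ξ => ?_⟩
  rw [weylInner, norm_mul, norm_phase, one_mul]
  exact h p q x ξ

lemma IsTame.continuous_weylInner (hB : IsTame b B) (f : 𝓢(Config d, ℂ)) (s : ℝ) :
    Continuous fun v : (Phase d × Config d) × Config d =>
      weylInner B f s v.1.1.1 v.1.1.2 v.1.2 v.2 := by
  unfold weylInner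
  refine Continuous.mul (by fun_prop) ?_
  exact (hB.continuous_innerIntegral f).comp (f := fun v : (Phase d × Config d) × Config d =>
    (v.1.2 + (2 * s) • v.1.1.2, v.2 - s • v.1.1.1, v.2 - (1 / 2 : ℝ) • v.1.1.1)) (by fun_prop)

lemma IsTame.integrable_weylInner (hB : IsTame b B) (f : 𝓢(Config d, ℂ)) (s : ℝ)
    (p q x : Config d) : Integrable (weylInner B f s p q x) := by
  obtain ⟨a, C, hC, h⟩ := hB.weylInner_bound f s
  refine (integrable_decayWeight.const_mul
    (C * ((1 + ‖p‖) * (1 + ‖q‖) * (1 + ‖x‖)) ^ a)).mono' ?_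
    (Filter.Eventually.of_forall fun ξ => h p q x ξ)
  exact ((hB.continuous_weylInner f s).comp
    (f := fun ξ => (((p, q), x), ξ)) (by fun_prop)).aestronglyMeasurable

lemma IsTame.weylAvg_bound (hB : IsTame b B) (f : 𝓢(Config d, ℂ)) (s : ℝ) :
    ∃ (a : ℕ) (C : ℝ), 0 ≤ C ∧ ∀ p q x : Config d, ‖weylAvg B f s x (p, q)‖ ≤
      C * ((1 + ‖p‖) * (1 + ‖q‖) * (1 + ‖x‖)) ^ a := by
  obtain ⟨a, C, hC, h⟩ := hB.weylInner_bound f s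
  have hI : 0 ≤ ∫ y : Config d, decayWeight y := integral_nonneg fun y => (decayWeight_pos y).le
  refine ⟨a, C * ∫ y : Config d, decayWeight y, by positivity, fun p q x => ?_⟩
  refine (norm_integral_le_of_norm_le (integrable_decayWeight.const_mul _)
    (Filter.Eventually.of_forall fun ξ => h p q x ξ)).trans_eq ?_
  rw [integral_const_mul]
  ring

lemma IsTame.continuous_weylAvg (hB : IsTame b B) (f : 𝓢(Config d, ℂ)) (s : ℝ) :
    Continuous fun v : Phase d × Config d => weylAvg B f s v.2 v.1 := by
  obtain ⟨a, C, hC, h⟩ := hB.weylInner_bound f s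
  have hc := hB.continuous_weylInner f s
  rw [continuous_iff_continuousAt]
  intro v₀
  set W : Phase d × Config d → ℝ := fun v =>
    C * ((1 + ‖v.1.1‖) * (1 + ‖v.1.2‖) * (1 + ‖v.2‖)) ^ a
  have hev : ∀ᶠ v in nhds v₀, W v < W v₀ + 1 := by
    refine ContinuousAt.eventually_lt ?_ continuousAt_const (by simp)
    fun_prop
  refine continuousAt_of_dominated (bound := fun ξ => (W v₀ + 1) * decayWeight ξ)
    (Filter.Eventually.of_forall fun v =>
      (hB.integrable_weylInner f s _ _ _).aestronglyMeasurable) ?_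
    (integrable_decayWeight.const_mul _) (Filter.Eventually.of_forall fun ξ => ?_)
  · filter_upwards [hev] with v hv
    refine Filter.Eventually.of_forall fun ξ => (h _ _ _ ξ).trans ?_
    have := (decayWeight_pos ξ).le
    gcongr
  · exact (hc.comp (f := fun v : Phase d × Config d => (v, ξ)) (by fun_prop)).continuousAt

lemma IsTame.integrable_tensor_mul_weylAvg (hB : IsTame b B) (φ ψ f : 𝓢(Config d, ℂ)) (s : ℝ)
    (x : Config d) : Integrable fun z : Phase d => φ z.1 * ψ z.2 * weylAvg B f s x z := by
  obtain ⟨a, C, hC, h⟩ := hB.weylAvg_bound f s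
  refine integrable_tensor_mul φ ψ (a := a) (C := C * (1 + ‖x‖) ^ a)
    ((hB.continuous_weylAvg f s).comp (f := fun z => (z, x)) (by fun_prop)) fun p q => ?_
  exact (h p q x).trans_eq (by rw [mul_pow _ (1 + ‖x‖)]; ring)

/-! ### Quantizing tensor products of Fourier transforms -/

lemma integrable_hat_midpoint_mul (φ : 𝓢(Config d, ℂ)) {h : Config d → ℂ} (hc : Continuous h)
    {a : ℕ} {C : ℝ} (hb : ∀ y, ‖h y‖ ≤ C * (1 + ‖y‖) ^ a) (x : Config d) :
    Integrable fun y => φ ((1 / 2 : ℝ) • (x + y)) * h y := by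
  obtain ⟨C', hC', h'⟩ := SchwartzMap.exists_one_add_pow_mul_le φ (a + (d + 1)) 0
  have hC : 0 ≤ C := by simpa using (norm_nonneg _).trans (hb 0)
  refine (integrable_decayWeight.const_mul
    (C * (2 * (1 + ‖x‖)) ^ (a + (d + 1)) * C')).mono' ?_ ?_
  · have := φ.continuous
    exact Continuous.aestronglyMeasurable (by fun_prop)
  · refine Filter.Eventually.of_forall fun y => ?_
    set u := (1 / 2 : ℝ) • (x + y) with hu
    have hy : 1 + ‖y‖ ≤ 2 * (1 + ‖x‖) * (1 + ‖u‖) := by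
      have e : y = (2 : ℝ) • u + -x := by simp only [hu]; module
      calc 1 + ‖y‖ = 1 + ‖(2 : ℝ) • u + -x‖ := by rw [← e]
        _ ≤ (1 + ‖(2 : ℝ) • u‖) * (1 + ‖-x‖) := one_add_norm_add_le _ _
        _ ≤ (2 * (1 + ‖u‖)) * (1 + ‖x‖) := by
          rw [norm_neg, norm_smul, Real.norm_ofNat]
          gcongr
          linarith
        _ = _ := by ring
    have h0 := h' u
    rw [norm_iteratedFDeriv_zero] at h0
    rw [decayWeight, ← div_eq_mul_inv, le_div_iff₀ (by positivity), norm_mul]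
    calc ‖φ u‖ * ‖h y‖ * (1 + ‖y‖) ^ (d + 1)
        ≤ ‖φ u‖ * (C * (1 + ‖y‖) ^ a) * (1 + ‖y‖) ^ (d + 1) := by gcongr; exact hb y
      _ = C * ((1 + ‖y‖) ^ (a + (d + 1)) * ‖φ u‖) := by ring
      _ ≤ C * ((2 * (1 + ‖x‖) * (1 + ‖u‖)) ^ (a + (d + 1)) * ‖φ u‖) := by gcongr
      _ = C * (2 * (1 + ‖x‖)) ^ (a + (d + 1)) * ((1 + ‖u‖) ^ (a + (d + 1)) * ‖φ u‖) := by
        rw [mul_pow _ (1 + ‖u‖)]; ring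
      _ ≤ _ := by gcongr

/-- The quantization of `hat φ ⊗ hat ψ` is a superposition of phase space translations. -/
lemma weylOp_tensor_hat (φ ψ : 𝓢(Config d, ℂ)) {h : Config d → ℂ} (hc : Continuous h)
    {a : ℕ} {C : ℝ} (hb : ∀ y, ‖h y‖ ≤ C * (1 + ‖y‖) ^ a) (x : Config d) :
    weylOp (tensor (hat φ) (hat ψ)) h x = ∫ z : Phase d, φ z.1 * ψ z.2 *
      (phase (inner ℝ z.1 (x + (1 / 2 : ℝ) • z.2)) * h (x + z.2)) := by
  have hC : 0 ≤ C := by simpa using (norm_nonneg _).trans (hb 0)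
  have hint := integrable_hat_midpoint_mul (hat φ) hc hb x
  have hsw : Integrable (Function.uncurry fun ξ y : Config d =>
      hat φ ((1 / 2 : ℝ) • (x + y)) * hat ψ ξ * phase (inner ℝ ξ (x - y)) * h y)
      (volume.prod volume) := by
    have hdom : Integrable (fun v : Config d × Config d =>
        hat ψ v.1 * (hat φ ((1 / 2 : ℝ) • (x + v.2)) * h v.2)) :=
      (hat ψ).integrable.mul_prod hint
    refine hdom.norm.mono' ?_ (Filter.Eventually.of_forall fun v => ?_)
    · have := (hat φ).continuous
      have := (hat ψ).continuous
      exact Continuous.aestronglyMeasurable (by simp only [Function.uncurry_def]; fun_prop)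
    · simp only [Function.uncurry, norm_mul, norm_phase]
      exact le_of_eq (by ring)
  have hint2 := integrable_tensor_mul φ ψ (a := a) (C := C * (1 + ‖x‖) ^ a)
    (R := fun z => phase (inner ℝ z.1 (x + (1 / 2 : ℝ) • z.2)) * h (x + z.2))
    (by fun_prop) (fun p q => by
      rw [norm_mul, norm_phase, one_mul]
      refine (hb _).trans ?_
      rw [mul_assoc, ← mul_pow]
      have h1 := one_add_norm_add_le x q
      gcongr
      refine h1.trans ?_
      gcongr
      nlinarith [norm_nonneg p, norm_nonneg q, mul_nonneg (norm_nonneg p) (norm_nonneg q)])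
  calc weylOp (tensor (hat φ) (hat ψ)) h x
      = weylConst d * ∫ y, ∫ ξ, hat φ ((1 / 2 : ℝ) • (x + y)) * hat ψ ξ *
          phase (inner ℝ ξ (x - y)) * h y := by
        rw [weylOp_eq', ← integral_integral_swap hsw]
        rfl
    -- With ξ integrated first, Fourier inversion turns hat ψ back into ψ; then y = x + q and hat φ
    -- is expanded.
    _ = ∫ y, hat φ ((1 / 2 : ℝ) • (x + y)) * h y * ψ (y - x) := by
        rw [← integral_const_mul]
        congr with y
        rw [← integral_hat_mul_phase ψ (y - x), ← weylConst]
        simp only [← integral_const_mul]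
        congr with ξ
        rw [← inner_neg_right, neg_sub]
        ring
    _ = ∫ q, hat φ (x + (1 / 2 : ℝ) • q) * h (x + q) * ψ q := by
        rw [← integral_add_left_eq_self _ x]
        congr with q
        congr 3
        · module
        · simp
    _ = ∫ q, ∫ p, φ p * ψ q * (phase (inner ℝ p (x + (1 / 2 : ℝ) • q)) * h (x + q)) := by
        congr with q
        rw [hat_apply, mul_assoc, ← integral_mul_const]
        congr with p
        ring
    _ = _ := (integral_prod_symm _ hint2).symm

lemma IsTame.weylOp_bound (hB : IsTame b B) (f : 𝓢(Config d, ℂ)) :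
    Continuous (weylOp B f) ∧ ∃ (a : ℕ) (C : ℝ), ∀ x, ‖weylOp B f x‖ ≤ C * (1 + ‖x‖) ^ a := by
  have e : weylOp B f = fun x => weylConst d * weylAvg B f 0 x 0 := funext (weylOp_eq B f)
  obtain ⟨a, C, hC, h⟩ := hB.weylAvg_bound f 0
  refine ⟨?_, a, ‖weylConst d‖ * C, fun x => ?_⟩
  · rw [e]
    exact continuous_const.mul
      ((hB.continuous_weylAvg f 0).comp (f := fun x => (0, x)) (by fun_prop))
  · rw [weylOp_eq, norm_mul, mul_assoc]
    gcongr
    have h0 := h 0 0 x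
    simp only [norm_zero, add_zero, one_mul] at h0
    exact h0

/-- The composition rule for Op(e_z) on the left of Op(B): the change of variable ξ ↦ ξ + p/2
produces the symbol e_z B(x + q/2, ξ - p/2). -/
lemma phase_mul_weylAvg_shift (B : Phase d → ℂ) (f : Config d → ℂ) (x : Config d) (z : Phase d) :
    phase (inner ℝ z.1 (x + (1 / 2 : ℝ) • z.2)) * weylAvg B f 0 (x + z.2) 0 =
      weylAvg B f (1 / 2) x z := by
  rw [weylAvg, weylAvg, ← integral_const_mul,
    ← integral_add_right_eq_self (weylInner B f (1 / 2) z.1 z.2 x) ((1 / 2 : ℝ) • z.1)]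
  congr with ξ
  simp only [weylInner, ← mul_assoc, ← phase_add]
  have e1 : x + (2 * (1 / 2 : ℝ)) • z.2 = x + z.2 := by module
  rw [e1, add_sub_cancel_right]
  congr 1
  · congr 1
    simp only [inner_add_right, inner_add_left, inner_smul_left, inner_smul_right]
    simp
    rw [real_inner_comm z.1 z.2, real_inner_comm ξ z.2]
    ring
  · simp

/-- `Op(hat φ ⊗ hat ψ) Op(B) f`. -/
lemma IsTame.weylOp_tensor_weylOp (hB : IsTame b B) (φ ψ f : 𝓢(Config d, ℂ)) (x : Config d) :
    weylOp (tensor (hat φ) (hat ψ)) (weylOp B f) x =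
      weylConst d * ∫ z : Phase d, φ z.1 * ψ z.2 * weylAvg B f (1 / 2) x z := by
  obtain ⟨hc, a, C, h⟩ := hB.weylOp_bound f
  rw [weylOp_tensor_hat φ ψ hc h, ← integral_const_mul]
  congr with z
  rw [weylOp_eq, ← phase_mul_weylAvg_shift]
  ring

lemma SchwartzMap.exists_shift_bound (f : 𝓢(Config d, ℂ)) (b : ℕ) :
    ∃ C : ℝ, 0 ≤ C ∧ ∀ y q, (1 + ‖y‖) ^ b * ‖f (y + q)‖ ≤
      C * (1 + ‖q‖) ^ (b + (d + 1)) * decayWeight y := by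
  obtain ⟨C, hC, h⟩ := SchwartzMap.exists_one_add_pow_mul_le f (b + (d + 1)) 0
  refine ⟨C, hC, fun y q => ?_⟩
  have h0 := h (y + q)
  rw [norm_iteratedFDeriv_zero] at h0
  have hy : 1 + ‖y‖ ≤ (1 + ‖y + q‖) * (1 + ‖q‖) := by
    have := one_add_norm_add_le (y + q) (-q)
    rwa [norm_neg, add_neg_cancel_right] at this
  rw [decayWeight, ← div_eq_mul_inv, le_div_iff₀ (by positivity)]
  calc _ = (1 + ‖y‖) ^ (b + (d + 1)) * ‖f (y + q)‖ := by ring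
    _ ≤ ((1 + ‖y + q‖) * (1 + ‖q‖)) ^ (b + (d + 1)) * ‖f (y + q)‖ := by gcongr
    _ = ((1 + ‖y + q‖) ^ (b + (d + 1)) * ‖f (y + q)‖) * (1 + ‖q‖) ^ (b + (d + 1)) := by
      rw [mul_pow]; ring
    _ ≤ _ := by gcongr

/-- `Op(B) Op(hat φ ⊗ hat ψ) f`. -/
lemma IsTame.weylOp_weylOp_tensor (hB : IsTame b B) (φ ψ f : 𝓢(Config d, ℂ)) (x : Config d) :
    weylOp B (weylOp (tensor (hat φ) (hat ψ)) f) x =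
      weylConst d * ∫ z : Phase d, φ z.1 * ψ z.2 * weylAvg B f (-(1 / 2)) x z := by
  obtain ⟨C₀, hC₀, hf₀⟩ := SchwartzMap.exists_one_add_pow_mul_le f 0 0
  have hf : ∀ y, ‖f y‖ ≤ C₀ * (1 + ‖y‖) ^ 0 := fun y => by simpa using hf₀ y
  have hfc := f.continuous
  have hBc := hB.1.continuous
  set Θ : Phase d → Config d → Config d → ℂ := fun z ξ y =>
    B ((1 / 2 : ℝ) • (x + y), ξ) * phase (inner ℝ ξ (x - y)) *
      (phase (inner ℝ z.1 (y + (1 / 2 : ℝ) • z.2)) * f (y + z.2)) with hΘ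
  -- Substituting y ↦ y - q undoes the translation of f and moves it to the argument of B.
  have hI : ∀ (z : Phase d) ξ, ∫ y, Θ z ξ y =
      phase (inner ℝ ξ (x + z.2) - inner ℝ z.1 z.2 / 2) *
        innerIntegral B f (x + (-1 : ℝ) • z.2) (ξ - (0 : ℝ) • z.1) (ξ - (1 : ℝ) • z.1) := by
    intro z ξ
    rw [innerIntegral, ← integral_const_mul, ← integral_sub_right_eq_self _ z.2]
    congr with y
    simp only [hΘ]
    have e1 : (1 / 2 : ℝ) • (x + (y - z.2)) = (1 / 2 : ℝ) • (x + (-1 : ℝ) • z.2 + y) := by module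
    have e2 : phase (inner ℝ ξ (x - (y - z.2))) *
        phase (inner ℝ z.1 (y - z.2 + (1 / 2 : ℝ) • z.2)) =
        phase (inner ℝ ξ (x + z.2) - inner ℝ z.1 z.2 / 2) *
          phase (-inner ℝ (ξ - (1 : ℝ) • z.1) y) := by
      simp only [← phase_add]
      congr 1
      simp only [inner_sub_left, inner_sub_right, inner_add_right, inner_smul_left,
        inner_smul_right]
      simp
      ring
    rw [e1, sub_add_cancel, zero_smul, sub_zero]
    linear_combination (B ((1 / 2 : ℝ) • (x + (-1 : ℝ) • z.2 + y), ξ) * f y) * e2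
  have hIavg : ∀ z : Phase d, ∫ ξ, ∫ y, Θ z ξ y = weylAvg B f (-(1 / 2)) x z := by
    intro z
    simp_rw [hI]
    -- The shift ξ ↦ ξ - p/2 symmetrizes the frequencies; here e_z acts from the right, which gives
    -- s = -1/2.
    rw [weylAvg, ← integral_sub_right_eq_self (weylInner B f (-(1 / 2)) z.1 z.2 x)
      ((1 / 2 : ℝ) • z.1)]
    congr with ξ
    rw [weylInner]
    have e1 : x + (2 * -(1 / 2) : ℝ) • z.2 = x + (-1 : ℝ) • z.2 := by module
    have e2 : ξ - (1 / 2 : ℝ) • z.1 - (-(1 / 2) : ℝ) • z.1 = ξ - (0 : ℝ) • z.1 := by module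
    have e3 : ξ - (1 / 2 : ℝ) • z.1 - (1 / 2 : ℝ) • z.1 = ξ - (1 : ℝ) • z.1 := by module
    rw [e1, e2, e3]
    congr 2
    simp only [inner_sub_right, inner_sub_left, inner_add_right, inner_smul_left, inner_smul_right]
    simp
    rw [real_inner_comm z.1 z.2, real_inner_comm ξ z.2]
    ring
  rw [weylOp_eq']
  congr 1
  simp_rw [← hIavg]
  rw [← integral_integral_tensor_mul_comm φ ψ]
  · congr with ξ
    congr with y
    rw [weylOp_tensor_hat φ ψ hfc hf, ← integral_const_mul]
    congr with z
    simp only [hΘ]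
    ring
  · intro ξ
    simp only [hΘ]
    fun_prop
  · intro ξ
    obtain ⟨-, C, hC, h⟩ := hB
    obtain ⟨C', hC', h'⟩ := SchwartzMap.exists_shift_bound f b
    refine ⟨b + (d + 1), C * ((1 + ‖x‖) * (1 + ‖ξ‖)) ^ b * C', fun p q y => ?_⟩
    have h0 := h 0 (by lia) ((1 / 2 : ℝ) • (x + y), ξ)
    rw [norm_iteratedFDeriv_zero] at h0
    simp only [hΘ, norm_mul, norm_phase, one_mul, mul_one]
    calc _ ≤ (C * ((1 + ‖x‖) * (1 + ‖y‖) * (1 + ‖ξ‖)) ^ b) * ‖f (y + q)‖ := by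
          gcongr
          refine h0.trans ?_
          gcongr
          exact one_add_norm_midpoint_le x y
      _ = C * ((1 + ‖x‖) * (1 + ‖ξ‖)) ^ b * ((1 + ‖y‖) ^ b * ‖f (y + q)‖) := by
          simp only [mul_pow]; ring
      _ ≤ C * ((1 + ‖x‖) * (1 + ‖ξ‖)) ^ b * (C' * (1 + ‖q‖) ^ (b + (d + 1)) * decayWeight y) :=
          mul_le_mul_of_nonneg_left (h' y q) (by positivity)
      _ ≤ C * ((1 + ‖x‖) * (1 + ‖ξ‖)) ^ b *
          (C' * ((1 + ‖p‖) * (1 + ‖q‖)) ^ (b + (d + 1)) * decayWeight y) := by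
          have := (decayWeight_pos y).le
          gcongr
          nlinarith [norm_nonneg p, norm_nonneg q, mul_nonneg (norm_nonneg p) (norm_nonneg q)]
      _ = _ := by ring
  · simp_rw [hI]
    refine Continuous.mul (by fun_prop) ?_
    exact (hB.continuous_innerIntegral f).comp (f := fun v : Phase d × Config d =>
      (x + (-1 : ℝ) • v.1.2, v.2 - (0 : ℝ) • v.1.1, v.2 - (1 : ℝ) • v.1.1)) (by fun_prop)
  · obtain ⟨a, C, hC, h⟩ := hB.innerIntegral_shift_bound f (-1) 0 1
    refine ⟨a, C * (1 + ‖x‖) ^ a, fun p q ξ => ?_⟩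
    rw [hI, norm_mul, norm_phase, one_mul]
    exact (h p q x ξ).trans_eq (by rw [mul_pow _ (1 + ‖x‖)]; ring)

/-- `Op((hat φ ⊗ hat ψ) B) f`. -/
lemma IsTame.weylOp_tensor_mul (hB : IsTame b B) (φ ψ f : 𝓢(Config d, ℂ)) (x : Config d) :
    weylOp (fun X => tensor (hat φ) (hat ψ) X * B X) f x =
      weylConst d * ∫ z : Phase d, φ z.1 * ψ z.2 * weylAvg B f 0 x z := by
  have hfc := f.continuous
  have hBc := hB.1.continuous
  set Θ : Phase d → Config d → Config d → ℂ := fun z ξ y =>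
    phase (inner ℝ z.1 ((1 / 2 : ℝ) • (x + y))) * phase (inner ℝ z.2 ξ) *
      B ((1 / 2 : ℝ) • (x + y), ξ) * phase (inner ℝ ξ (x - y)) * f y with hΘ
  have hI : ∀ (z : Phase d) ξ, ∫ y, Θ z ξ y = weylInner B f 0 z.1 z.2 x ξ := by
    intro z ξ
    rw [weylInner_eq]
    simp [hΘ]
  rw [weylOp_eq']
  congr 1
  simp_rw [weylAvg, ← hI]
  rw [← integral_integral_tensor_mul_comm φ ψ]
  · congr with ξ
    congr with y
    have e : tensor (hat φ) (hat ψ) ((1 / 2 : ℝ) • (x + y), ξ) =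
        ∫ z : Phase d, (φ z.1 * phase (inner ℝ z.1 ((1 / 2 : ℝ) • (x + y)))) *
          (ψ z.2 * phase (inner ℝ z.2 ξ)) := by
      rw [tensor_apply, hat_apply, hat_apply]
      exact (integral_prod_mul (fun p => φ p * phase (inner ℝ p ((1 / 2 : ℝ) • (x + y))))
        (fun q => ψ q * phase (inner ℝ q ξ))).symm
    rw [e, mul_assoc, mul_assoc, ← integral_mul_const]
    congr with z
    simp only [hΘ]
    ring
  · intro ξ
    simp only [hΘ]
    fun_prop
  · intro ξ
    obtain ⟨C, hC, h⟩ := hB.integrand_bound f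
    refine ⟨0, C * ((1 + ‖x‖) * (1 + ‖ξ‖)) ^ b, fun p q y => ?_⟩
    have h0 := h 0 (by lia) x ξ y
    rw [norm_iteratedFDeriv_zero, norm_mul] at h0
    simpa only [hΘ, norm_mul, norm_phase, one_mul, mul_one, pow_zero] using h0
  · simp_rw [hI]
    exact (hB.continuous_weylInner f 0).comp
      (f := fun v : Phase d × Config d => ((v.1, x), v.2)) (by fun_prop)
  · obtain ⟨a, C, hC, h⟩ := hB.weylInner_bound f 0
    refine ⟨a, C * (1 + ‖x‖) ^ a, fun p q ξ => ?_⟩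
    rw [hI]
    exact (h p q x ξ).trans_eq (by rw [mul_pow _ (1 + ‖x‖)]; ring)

/-! ### Injectivity of the Weyl quantization -/

/-- If M(z) ≠ 0, the real part of conj(M(z)) M is positive on a ball around z. A product of two
bumps is supported in that ball, because the distance on the product is the maximum, and its
integral against this real part is positive. -/
lemma eq_zero_of_forall_integral_tensor_mul_eq_zero {M : Phase d → ℂ} (hM : Continuous M)
    (h : ∀ φ ψ : 𝓢(Config d, ℂ), ∫ z : Phase d, φ z.1 * ψ z.2 * M z = 0) (z : Phase d) :
    M z = 0 := by
  by_contra hz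
  set g : Phase d → ℝ := fun w => ((starRingEnd ℂ) (M z) * M w).re with hg
  have hgc : Continuous g := by fun_prop
  have hgz : 0 < g z := by
    have : g z = ‖M z‖ ^ 2 := by
      simp only [hg]
      rw [mul_comm, Complex.mul_conj, Complex.ofReal_re, Complex.normSq_eq_norm_sq]
    rw [this]
    have := norm_pos_iff.2 hz
    positivity
  obtain ⟨r, hr, hball⟩ := Metric.eventually_nhds_iff.1
    ((continuousAt_const (y := (0 : ℝ))).eventually_lt hgc.continuousAt hgz)
  let χ (c : Config d) : ContDiffBump c := ⟨r / 4, r / 2, by positivity, by linarith⟩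
  have hχ0 : ∀ c x, r / 2 ≤ dist x c → χ c x = 0 := fun c x hx => (χ c).zero_of_le_dist hx
  have hcs : ∀ c, HasCompactSupport fun x => ((χ c x : ℝ) : ℂ) := fun c =>
    (χ c).hasCompactSupport.comp_left (g := fun t : ℝ => (t : ℂ)) (by simp)
  have hsm : ∀ c, ContDiff ℝ ∞ fun x => ((χ c x : ℝ) : ℂ) := fun c =>
    Complex.ofRealCLM.contDiff.comp (χ c).contDiff
  set F : Phase d → ℝ := fun w => χ z.1 w.1 * χ z.2 w.2 * g w with hF
  have hout : ∀ w, r ≤ dist w z → F w = 0 := by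
    intro w hw
    rw [Prod.dist_eq, le_max_iff] at hw
    rcases hw with hw | hw
    · simp [hF, hχ0 z.1 w.1 (by linarith)]
    · simp [hF, hχ0 z.2 w.2 (by linarith)]
  have hc1 : Continuous fun w : Phase d => χ z.1 w.1 := (χ z.1).continuous.comp continuous_fst
  have hc2 : Continuous fun w : Phase d => χ z.2 w.2 := (χ z.2).continuous.comp continuous_snd
  have hpos : 0 < ∫ w, F w := by
    refine Continuous.integral_pos_of_hasCompactSupport_nonneg_nonzero (x := z)
      ((hc1.mul hc2).mul hgc) ?_ ?_ ?_
    · refine HasCompactSupport.intro (isCompact_closedBall z r) fun w hw => hout w ?_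
      rw [Metric.mem_closedBall, not_le] at hw
      exact hw.le
    · intro w
      rcases lt_or_ge (dist w z) r with hw | hw
      · exact mul_nonneg (mul_nonneg (χ z.1).nonneg (χ z.2).nonneg) (hball hw).le
      · exact (hout w hw).ge
    · have h1 : χ z.1 z.1 = 1 := (χ z.1).one_of_mem_closedBall (by simp [χ]; positivity)
      have h2 : χ z.2 z.2 = 1 := (χ z.2).one_of_mem_closedBall (by simp [χ]; positivity)
      simp [hF, h1, h2, hgz.ne']
  set φ := (hcs z.1).toSchwartzMap (hsm z.1)
  set ψ := (hcs z.2).toSchwartzMap (hsm z.2)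
  have hre : ∫ w, F w = ((starRingEnd ℂ) (M z) * ∫ w : Phase d, φ w.1 * ψ w.2 * M w).re := by
    rw [← integral_const_mul, ← Complex.reCLM_apply, ← ContinuousLinearMap.integral_comp_comm]
    · congr with w
      change χ z.1 w.1 * χ z.2 w.2 * ((starRingEnd ℂ) (M z) * M w).re =
        ((starRingEnd ℂ) (M z) * (((χ z.1 w.1 : ℝ) : ℂ) * ((χ z.2 w.2 : ℝ) : ℂ) * M w)).re
      rw [← Complex.ofReal_mul, mul_left_comm, Complex.re_ofReal_mul]
    · refine Continuous.integrable_of_hasCompactSupport ?_ ?_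
      · have := φ.continuous
        have := ψ.continuous
        fun_prop
      · refine HasCompactSupport.intro (isCompact_closedBall z r) fun w hw => ?_
        rw [Metric.mem_closedBall, not_le, Prod.dist_eq, lt_max_iff] at hw
        change (starRingEnd ℂ) (M z) * (((χ z.1 w.1 : ℝ) : ℂ) * ((χ z.2 w.2 : ℝ) : ℂ) * M w) = 0
        rcases hw with hw | hw
        · simp [hχ0 z.1 w.1 (by linarith)]
        · simp [hχ0 z.2 w.2 (by linarith)]
  rw [hre, h φ ψ] at hpos
  simp at hpos

/-! ### Polynomial growth and pairing with Gaussians -/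

/-- Polynomial growth on phase space. -/
def IsPolyBounded (F : Phase d → ℂ) : Prop :=
  ∃ (a : ℕ) (C : ℝ), 0 ≤ C ∧ ∀ X, ‖F X‖ ≤ C * ((1 + ‖X.1‖) * (1 + ‖X.2‖)) ^ a

lemma IsPolyBounded.sub {F G : Phase d → ℂ} (hF : IsPolyBounded F) (hG : IsPolyBounded G) :
    IsPolyBounded fun X => F X - G X := by
  obtain ⟨a, C, hC, h⟩ := hF
  obtain ⟨a', C', hC', h'⟩ := hG
  refine ⟨max a a', C + C', by positivity, fun X => ?_⟩
  have h1 : 1 ≤ (1 + ‖X.1‖) * (1 + ‖X.2‖) := by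
    nlinarith [norm_nonneg X.1, norm_nonneg X.2, mul_nonneg (norm_nonneg X.1) (norm_nonneg X.2)]
  calc _ ≤ ‖F X‖ + ‖G X‖ := norm_sub_le _ _
    _ ≤ C * ((1 + ‖X.1‖) * (1 + ‖X.2‖)) ^ (max a a') +
        C' * ((1 + ‖X.1‖) * (1 + ‖X.2‖)) ^ (max a a') := by
      refine add_le_add ((h X).trans ?_) ((h' X).trans ?_)
      · exact mul_le_mul_of_nonneg_left (pow_le_pow_right₀ h1 (le_max_left _ _)) hC
      · exact mul_le_mul_of_nonneg_left (pow_le_pow_right₀ h1 (le_max_right _ _)) hC'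
    _ = _ := by ring

lemma IsPolyBounded.comp_add {F : Phase d → ℂ} (hF : IsPolyBounded F) (Z : Phase d) :
    IsPolyBounded fun X => F (X + Z) := by
  obtain ⟨a, C, hC, h⟩ := hF
  refine ⟨a, C * ((1 + ‖Z.1‖) * (1 + ‖Z.2‖)) ^ a, by positivity, fun X => (h _).trans ?_⟩
  calc _ ≤ C * (((1 + ‖X.1‖) * (1 + ‖Z.1‖)) * ((1 + ‖X.2‖) * (1 + ‖Z.2‖))) ^ a := by
        gcongr <;> exact one_add_norm_add_le _ _
    _ = _ := by simp only [mul_pow]; ring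

lemma IsTame.isPolyBounded {b : ℕ} {B : Phase d → ℂ} (hB : IsTame b B) : IsPolyBounded B := by
  obtain ⟨-, C, hC, h⟩ := hB
  exact ⟨b, C, hC, fun X => by simpa using h 0 (by lia) X⟩

lemma exists_pow_mul_exp_neg_sq_le_decayWeight (a : ℕ) :
    ∃ C : ℝ, 0 ≤ C ∧ ∀ x : Config d,
      (1 + ‖x‖) ^ a * Real.exp (-‖x‖ ^ 2) ≤ C * decayWeight x := by
  refine ⟨(a + (d + 1)).factorial * Real.exp (3 / 2), by positivity, fun x => ?_⟩
  rw [decayWeight, ← div_eq_mul_inv, le_div_iff₀ (by positivity)]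
  refine le_trans ?_ (pow_mul_exp_neg_sq_le (a + (d + 1)) (norm_nonneg x))
  rw [mul_right_comm, ← pow_add]
  gcongr
  nlinarith [sq_nonneg ‖x‖]

/-- The Gaussian `exp (-|x|² - |ξ|²)` on phase space. -/
def phaseGaussian (X : Phase d) : ℂ := (Real.exp (-‖X.1‖ ^ 2) * Real.exp (-‖X.2‖ ^ 2) : ℝ)

lemma phaseGaussian_ne_zero (X : Phase d) : phaseGaussian X ≠ 0 := by
  rw [phaseGaussian, Complex.ofReal_ne_zero]; positivity

lemma continuous_phaseGaussian : Continuous (phaseGaussian (d := d)) := by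
  unfold phaseGaussian; fun_prop

lemma IsPolyBounded.integrable_mul_phaseGaussian {F : Phase d → ℂ} (hF : IsPolyBounded F)
    (hFc : Continuous F) : Integrable fun X => F X * phaseGaussian X := by
  obtain ⟨a, C, hC, h⟩ := hF
  obtain ⟨C', hC', h'⟩ := exists_pow_mul_exp_neg_sq_le_decayWeight (d := d) a
  have hdom : Integrable fun X : Phase d => decayWeight X.1 * decayWeight X.2 :=
    integrable_decayWeight.mul_prod integrable_decayWeight
  refine (hdom.const_mul (C * C' * C')).mono' (hFc.mul continuous_phaseGaussian).aestronglyMeasurable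
    (Filter.Eventually.of_forall fun X => ?_)
  rw [norm_mul, phaseGaussian, Complex.norm_real, Real.norm_of_nonneg (by positivity)]
  calc _ ≤ C * ((1 + ‖X.1‖) * (1 + ‖X.2‖)) ^ a *
        (Real.exp (-‖X.1‖ ^ 2) * Real.exp (-‖X.2‖ ^ 2)) := by gcongr; exact h X
    _ = C * (((1 + ‖X.1‖) ^ a * Real.exp (-‖X.1‖ ^ 2)) *
        ((1 + ‖X.2‖) ^ a * Real.exp (-‖X.2‖ ^ 2))) := by rw [mul_pow]; ring
    _ ≤ C * ((C' * decayWeight X.1) * (C' * decayWeight X.2)) := by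
        refine mul_le_mul_of_nonneg_left (mul_le_mul (h' _) (h' _) (by positivity) ?_) hC
        have := (decayWeight_pos X.1).le
        positivity
    _ = _ := by ring

lemma integral_phase_mul_gaussian (ξ τ : Config d) :
    ∫ w, phase (-inner ℝ ξ w) * (Real.exp (-(1 / 4) * ‖w - τ‖ ^ 2) : ℝ) =
      (Real.pi / (1 / 4 : ℂ)) ^ (d / 2 : ℂ) * (Real.exp (-‖ξ‖ ^ 2) : ℝ) *
        phase (-inner ℝ ξ τ) := by
  rw [← integral_add_right_eq_self _ τ]
  have h := GaussianFourier.integral_cexp_neg_mul_sq_norm_add (V := Config d) (b := 1 / 4)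
    (by norm_num) (-Complex.I) ξ
  rw [finrank_euclideanSpace, Fintype.card_fin] at h
  have e : ∀ w, phase (-inner ℝ ξ (w + τ)) * (Real.exp (-(1 / 4) * ‖w + τ - τ‖ ^ 2) : ℝ) =
      Complex.exp (-(1 / 4) * ‖w‖ ^ 2 + -Complex.I * inner ℝ ξ w) * phase (-inner ℝ ξ τ) := by
    intro w
    rw [inner_add_right, neg_add, phase_add, add_sub_cancel_right, Complex.ofReal_exp,
      Complex.exp_add, phase]
    push_cast
    rw [mul_neg, neg_mul Complex.I]
    ring
  simp_rw [e]
  rw [integral_mul_const, h]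
  congr 2
  rw [Complex.ofReal_exp]
  congr 1
  push_cast
  simp

/-- By the parallelogram law the two Gaussians decouple into one in the midpoint u and one in the
difference w. The w-integral in the Weyl pairing is then an explicit Gaussian Fourier transform. -/
lemma wavePacket_mul_wavePacket (τ t u w : Config d) :
    wavePacket (-((1 / 2 : ℝ) • τ)) ((1 / 2 : ℝ) • t) (u - (1 / 2 : ℝ) • w) *
      wavePacket ((1 / 2 : ℝ) • τ) ((1 / 2 : ℝ) • t) (u + (1 / 2 : ℝ) • w) =
    phase (inner ℝ t u) * (Real.exp (-‖u‖ ^ 2) : ℝ) *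
      (Real.exp (-(1 / 4) * ‖w - τ‖ ^ 2) : ℝ) := by
  rw [wavePacket_apply, wavePacket_apply, mul_mul_mul_comm, ← phase_add, mul_assoc,
    ← Complex.ofReal_mul, ← Complex.ofReal_mul, ← Real.exp_add, ← Real.exp_add]
  have e1 : u - (1 / 2 : ℝ) • w - -((1 / 2 : ℝ) • τ) = u - (1 / 2 : ℝ) • (w - τ) := by module
  have e2 : u + (1 / 2 : ℝ) • w - (1 / 2 : ℝ) • τ = u + (1 / 2 : ℝ) • (w - τ) := by module
  have e3 := parallelogram_law_with_norm ℝ u ((1 / 2 : ℝ) • (w - τ))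
  rw [norm_smul (1 / 2 : ℝ) (w - τ)] at e3
  norm_num at e3
  rw [e1, e2]
  congr 3
  · simp only [inner_sub_right, inner_add_right, inner_smul_left, inner_smul_right]
    simp
    ring
  · norm_num
    nlinarith [e3]

/-- Weyl quantization of a function of polynomial growth, paired with Gaussian wave packets. -/
lemma integral_mul_phaseGaussian_eq_zero {F : Phase d → ℂ} (hF : IsPolyBounded F)
    (hFc : Continuous F)
    (hint : ∀ f g : 𝓢(Config d, ℂ), Integrable fun v : Config d × Config d =>
      g v.1 * ∫ y, F ((1 / 2 : ℝ) • (v.1 + y), v.2) * phase (inner ℝ v.2 (v.1 - y)) * f y)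
    (h0 : ∀ (f : 𝓢(Config d, ℂ)) (x : Config d),
      ∫ ξ, ∫ y, F ((1 / 2 : ℝ) • (x + y), ξ) * phase (inner ℝ ξ (x - y)) * f y = 0)
    (t τ : Config d) :
    ∫ X : Phase d, F X * phaseGaussian X * (phase (inner ℝ t X.1) * phase (inner ℝ τ X.2)) = 0 := by
  -- The centres use -τ so that the Gaussian integral in w yields the phase with +τ·ξ.
  set f := wavePacket ((1 / 2 : ℝ) • -τ) ((1 / 2 : ℝ) • t)
  set g := wavePacket (-((1 / 2 : ℝ) • -τ)) ((1 / 2 : ℝ) • t)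
  have hfc := f.continuous
  have hgc := g.continuous
  set κ : ℂ := (Real.pi / (1 / 4 : ℂ)) ^ (d / 2 : ℂ) with hκ
  have hκ0 : κ ≠ 0 := by
    rw [hκ, Complex.cpow_ne_zero_iff]
    left
    simp [Real.pi_ne_zero]
  have hpair : ∀ ξ, ∫ x, g x * ∫ y, F ((1 / 2 : ℝ) • (x + y), ξ) *
      phase (inner ℝ ξ (x - y)) * f y =
      κ * ∫ u, F (u, ξ) * phaseGaussian (u, ξ) *
        (phase (inner ℝ t u) * phase (inner ℝ τ ξ)) := by
    intro ξ
    set K : Config d × Config d → ℂ := fun v =>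
      g v.1 * (F ((1 / 2 : ℝ) • (v.1 + v.2), ξ) * phase (inner ℝ ξ (v.1 - v.2)) * f v.2) with hK
    have hKint : Integrable K := by
      obtain ⟨a, C, hC, h⟩ := hF
      refine ((integrable_tensorWeight g f a).const_mul (C * (1 + ‖ξ‖) ^ a)).mono'
        (Continuous.aestronglyMeasurable (by simp only [hK]; fun_prop))
        (Filter.Eventually.of_forall fun v => ?_)
      simp only [hK, norm_mul, norm_phase, mul_one]
      calc _ ≤ ‖g v.1‖ * (C * (((1 + ‖v.1‖) * (1 + ‖v.2‖)) * (1 + ‖ξ‖)) ^ a * ‖f v.2‖) := by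
            gcongr
            refine (h _).trans ?_
            gcongr
            exact one_add_norm_midpoint_le _ _
        _ = _ := by rw [tensorWeight]; simp only [mul_pow]; ring
    -- Passage to midpoint and difference in two steps: the measure-preserving shear y = x + w, then
    -- x = u - w/2 at fixed w.
    have hKshear : Integrable fun v : Config d × Config d => K (v.1, v.1 + v.2) :=
      (measurePreserving_prod_add (volume : Measure (Config d)) volume).integrable_comp_of_integrable
        hKint
    calc _ = ∫ x, ∫ y, K (x, y) := by simp only [hK, integral_const_mul]
      _ = ∫ x, ∫ w, K (x, x + w) := by
          congr with x
          rw [integral_add_left_eq_self (fun y => K (x, y)) x]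
      _ = ∫ w, ∫ x, K (x, x + w) := integral_integral_swap hKshear
      _ = ∫ w, ∫ u, K (u - (1 / 2 : ℝ) • w, u + (1 / 2 : ℝ) • w) := by
          congr with w
          rw [← integral_sub_right_eq_self (fun x => K (x, x + w)) ((1 / 2 : ℝ) • w)]
          congr with u
          congr 2
          module
      _ = ∫ w, ∫ u, (F (u, ξ) * (phase (inner ℝ t u) * (Real.exp (-‖u‖ ^ 2) : ℝ))) *
            (phase (-inner ℝ ξ w) * (Real.exp (-(1 / 4) * ‖w - -τ‖ ^ 2) : ℝ)) := by
          congr with w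
          congr with u
          have e1 : (1 / 2 : ℝ) • (u - (1 / 2 : ℝ) • w + (u + (1 / 2 : ℝ) • w)) = u := by module
          have e2 : u - (1 / 2 : ℝ) • w - (u + (1 / 2 : ℝ) • w) = -w := by module
          simp only [hK, e1, e2, inner_neg_right]
          linear_combination (F (u, ξ) * phase (-inner ℝ ξ w)) *
            wavePacket_mul_wavePacket (-τ) t u w
      _ = (∫ u, F (u, ξ) * (phase (inner ℝ t u) * (Real.exp (-‖u‖ ^ 2) : ℝ))) *
            (κ * (Real.exp (-‖ξ‖ ^ 2) : ℝ) * phase (-inner ℝ ξ (-τ))) := by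
          simp_rw [integral_mul_const]
          rw [integral_const_mul, integral_phase_mul_gaussian]
      _ = _ := by
          rw [← integral_mul_const, ← integral_const_mul]
          congr with u
          rw [phaseGaussian, inner_neg_right, neg_neg, real_inner_comm τ ξ]
          push_cast
          ring
  have hFG : Integrable fun X : Phase d =>
      F X * phaseGaussian X * (phase (inner ℝ t X.1) * phase (inner ℝ τ X.2)) := by
    refine (hF.integrable_mul_phaseGaussian hFc).norm.mono' ?_
      (Filter.Eventually.of_forall fun X => ?_)
    · have := continuous_phaseGaussian (d := d)
      exact Continuous.aestronglyMeasurable (by fun_prop)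
    · simp
  rw [show (volume : Measure (Phase d)) = volume.prod volume from rfl, integral_prod_symm _ hFG]
  refine (mul_eq_zero.1 ?_).resolve_left hκ0
  rw [← integral_const_mul]
  simp_rw [← hpair]
  -- Up to κ the integral is now the pairing of g with the quantization of F applied to f, which
  -- vanishes by `h0`.
  rw [← integral_integral_swap (hint f g)]
  simp_rw [integral_const_mul, h0]
  simp

/-- A function of polynomial growth with vanishing Weyl quantization is zero. -/
lemma eq_zero_of_weyl_eq_zero {F : Phase d → ℂ} (hF : IsPolyBounded F)
    (hFc : Continuous F)
    (hint : ∀ f g : 𝓢(Config d, ℂ), Integrable fun v : Config d × Config d =>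
      g v.1 * ∫ y, F ((1 / 2 : ℝ) • (v.1 + y), v.2) * phase (inner ℝ v.2 (v.1 - y)) * f y)
    (h0 : ∀ (f : 𝓢(Config d, ℂ)) (x : Config d),
      ∫ ξ, ∫ y, F ((1 / 2 : ℝ) • (x + y), ξ) * phase (inner ℝ ξ (x - y)) * f y = 0)
    (X : Phase d) : F X = 0 := by
  have hG := continuous_phaseGaussian (d := d)
  refine (mul_eq_zero.1 (eq_zero_of_forall_integral_tensor_mul_eq_zero
    (M := fun X => F X * phaseGaussian X) (hFc.mul hG) (fun φ' ψ' => ?_) X)).resolve_right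
    (phaseGaussian_ne_zero X)
  obtain ⟨φ, rfl⟩ := hat_surjective φ'
  obtain ⟨ψ, rfl⟩ := hat_surjective ψ'
  -- Writing the test function as a Fourier integral reduces its pairing with F times the Gaussian
  -- to the vanishing Fourier transform of that product.
  have e : ∀ X : Phase d, hat φ X.1 * hat ψ X.2 * (F X * phaseGaussian X) =
      ∫ z : Phase d, φ z.1 * ψ z.2 *
        (F X * phaseGaussian X * (phase (inner ℝ z.1 X.1) * phase (inner ℝ z.2 X.2))) := by
    intro X
    rw [hat_apply, hat_apply, ← integral_prod_mul, ← integral_mul_const]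
    congr with z
    ring
  simp_rw [e]
  have := φ.continuous
  have := ψ.continuous
  rw [integral_integral_swap]
  · simp_rw [integral_const_mul, integral_mul_phaseGaussian_eq_zero hF hFc hint h0]
    simp
  · have hdom : Integrable (fun v : Phase d × Phase d =>
        (F v.1 * phaseGaussian v.1) * (φ v.2.1 * ψ v.2.2)) :=
      (hF.integrable_mul_phaseGaussian hFc).mul_prod (φ.integrable.mul_prod ψ.integrable)
    refine hdom.norm.mono' ?_ (Filter.Eventually.of_forall fun v => ?_)
    · exact Continuous.aestronglyMeasurable (by simp only [Function.uncurry_def]; fun_prop)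
    · simp only [Function.uncurry, norm_mul, norm_phase]
      exact le_of_eq (by ring)

/-! ### Functions with `H(X + Z) - H(X - Z) = 2 DH(X) Z` -/

/-- Differentiating in Z gives Jensen's equation for DH, so DH - DH(0) is additive; continuity makes
it linear, and integration along rays recovers H. -/
lemma eq_quadratic_of_symmetric_difference {V : Type*} [NormedAddCommGroup V] [NormedSpace ℝ V]
    {H : V → ℂ} (hH : ContDiff ℝ 1 H)
    (h : ∀ X Z, H (X + Z) - H (X - Z) = 2 * fderiv ℝ H X Z) :
    ∃ ℓ : V →L[ℝ] V →L[ℝ] ℂ, ∀ X, H X = H 0 + fderiv ℝ H 0 X + (1 / 2) * ℓ X X := by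
  have hd : Differentiable ℝ H := hH.differentiable one_ne_zero
  have hsum : ∀ X Z, fderiv ℝ H (X + Z) + fderiv ℝ H (X - Z) = fderiv ℝ H X + fderiv ℝ H X := by
    intro X Z
    have h1 : HasFDerivAt (fun Z => H (X + Z)) (fderiv ℝ H (X + Z)) Z := by
      have := (hd (X + Z)).hasFDerivAt.comp Z ((hasFDerivAt_id Z).const_add X)
      rw [ContinuousLinearMap.comp_id] at this
      exact this
    have h2 : HasFDerivAt (fun Z => H (X - Z)) (-fderiv ℝ H (X - Z)) Z := by
      have := (hd (X - Z)).hasFDerivAt.comp Z ((hasFDerivAt_id Z).const_sub X)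
      rw [ContinuousLinearMap.comp_neg, ContinuousLinearMap.comp_id] at this
      exact this
    have h3 : HasFDerivAt (fun Z => 2 * fderiv ℝ H X Z) ((2 : ℂ) • fderiv ℝ H X) Z :=
      (fderiv ℝ H X).hasFDerivAt.const_mul 2
    have h4 := (h1.sub h2).unique (h3.congr_of_eventuallyEq (Filter.Eventually.of_forall (h X)))
    rw [sub_neg_eq_add] at h4
    rw [h4]
    ext v
    simp [two_mul]
  set L : V → V →L[ℝ] ℂ := fun X => fderiv ℝ H X - fderiv ℝ H 0 with hL
  have hLc : Continuous L := (hH.continuous_fderiv one_ne_zero).sub continuous_const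
  have hL2 : ∀ X Z, L (X + Z) + L (X - Z) = L X + L X := by
    intro X Z
    have := hsum X Z
    calc L (X + Z) + L (X - Z) = fderiv ℝ H (X + Z) + fderiv ℝ H (X - Z) -
          (fderiv ℝ H 0 + fderiv ℝ H 0) := by simp only [hL]; abel
      _ = L X + L X := by rw [this]; simp only [hL]; abel
  have hneg : ∀ Z, L (-Z) = -L Z := by
    intro Z
    have := hL2 0 Z
    rw [zero_add, zero_sub, show L 0 = 0 from sub_self _, add_zero] at this
    exact eq_neg_of_add_eq_zero_right this
  -- Average Jensen's equation with its version where X and Z are exchanged; the differences cancel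
  -- because L is odd.
  have hadd : ∀ X Z, L (X + Z) = L X + L Z := by
    intro X Z
    have h1 := hL2 X Z
    have h2 := hL2 Z X
    rw [← neg_sub X Z, hneg, add_comm Z X] at h2
    ext v
    have h3 := congrArg (fun A : V →L[ℝ] ℂ => A v) h1
    have h4 := congrArg (fun A : V →L[ℝ] ℂ => A v) h2
    simp only [add_apply, neg_apply] at h3 h4 ⊢
    linear_combination (1 / 2 : ℂ) * h3 + (1 / 2 : ℂ) * h4
  set ℓ : V →L[ℝ] V →L[ℝ] ℂ := (AddMonoidHom.mk' L hadd).toRealLinearMap hLc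
  have hℓ : ∀ X, ℓ X = fderiv ℝ H X - fderiv ℝ H 0 := fun X => rfl
  refine ⟨ℓ, fun X => ?_⟩
  set g : ℝ → ℂ := fun t => H (t • X) - t * fderiv ℝ H 0 X - (1 / 2) * (t : ℂ) ^ 2 * ℓ X X with hg
  have hgd : ∀ t, HasDerivAt g 0 t := by
    intro t
    have hlin : HasDerivAt (fun t : ℝ => t • X) X t := by
      simpa using (hasDerivAt_id t).smul_const X
    have h1 : HasDerivAt (fun t : ℝ => H (t • X)) (fderiv ℝ H (t • X) X) t :=
      (hd (t • X)).hasFDerivAt.comp_hasDerivAt t hlin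
    have h2 : HasDerivAt (fun t : ℝ => (t : ℂ)) 1 t := Complex.ofRealCLM.hasDerivAt
    have h3 := (h1.sub (h2.mul_const (fderiv ℝ H 0 X))).sub
      (((h2.pow 2).const_mul (1 / 2 : ℂ)).mul_const (ℓ X X))
    refine HasDerivAt.congr_deriv (f := g) h3 ?_
    have e : fderiv ℝ H (t • X) X = t * ℓ X X + fderiv ℝ H 0 X := by
      have : ℓ (t • X) X = t * ℓ X X := by simp
      rw [← this, hℓ (t • X)]
      simp
    rw [e]
    push_cast
    ring
  have hc := is_const_of_deriv_eq_zero (fun t => (hgd t).differentiableAt) (fun t => (hgd t).deriv)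
    1 0
  simp only [hg, one_smul, zero_smul] at hc
  push_cast at hc
  linear_combination hc

lemma isPolynomialOfDegreeLE_two {H : Phase d → ℂ} (c : ℂ) (l : Phase d →L[ℝ] ℂ)
    (ℓ : Phase d →L[ℝ] Phase d →L[ℝ] ℂ) (h : ∀ X, H X = c + l X + (1 / 2) * ℓ X X) :
    IsPolynomialOfDegreeLE 2 H := by
  let E : Fin d ⊕ Fin d → Phase d :=
    Sum.elim (fun j => (EuclideanSpace.single j 1, 0)) (fun j => (0, EuclideanSpace.single j 1))
  let co (X : Phase d) : Fin d ⊕ Fin d → ℝ := Sum.elim (fun j => X.1 j) (fun j => X.2 j)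
  have hsingle : ∀ x : Config d, x = ∑ j, x j • EuclideanSpace.single j (1 : ℝ) := by
    intro x
    ext i
    simp [Pi.single_apply]
  have hX : ∀ X : Phase d, X = ∑ i, co X i • E i := by
    intro X
    rw [Fintype.sum_sum_type]
    ext1
    · simp [E, co, Prod.fst_sum, ← hsingle]
    · simp [E, co, Prod.snd_sum, ← hsingle]
  refine ⟨MvPolynomial.C c + ∑ i, MvPolynomial.C (l (E i)) * MvPolynomial.X i +
    ∑ i, ∑ k, MvPolynomial.C ((1 / 2) * ℓ (E i) (E k)) *
      (MvPolynomial.X i * MvPolynomial.X k), ?_, fun X => ?_⟩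
  · have hC : ∀ (a : ℂ) (p : MvPolynomial (Fin d ⊕ Fin d) ℂ),
        (MvPolynomial.C a * p).totalDegree ≤ p.totalDegree := fun a p =>
      (MvPolynomial.totalDegree_mul _ _).trans (by simp)
    refine (MvPolynomial.totalDegree_add _ _).trans (max_le
      ((MvPolynomial.totalDegree_add _ _).trans (max_le (by simp) ?_)) ?_)
    · refine MvPolynomial.totalDegree_finsetSum_le fun i _ => (hC _ _).trans ?_
      rw [MvPolynomial.totalDegree_X]
      exact one_le_two
    · refine MvPolynomial.totalDegree_finsetSum_le fun i _ =>
        MvPolynomial.totalDegree_finsetSum_le fun k _ => (hC _ _).trans ?_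
      refine (MvPolynomial.totalDegree_mul _ _).trans ?_
      rw [MvPolynomial.totalDegree_X, MvPolynomial.totalDegree_X]
  · have hco : (Sum.elim (fun j => ((X.1 j : ℝ) : ℂ)) (fun j => ((X.2 j : ℝ) : ℂ)) :
        Fin d ⊕ Fin d → ℂ) = fun i => ((co X i : ℝ) : ℂ) := by
      ext i; cases i <;> rfl
    rw [hco, h X]
    have h1 : l X = ∑ i, (co X i : ℂ) * l (E i) := by
      conv_lhs => rw [hX X]
      simp [map_sum]
    have h2 : ℓ X X = ∑ i, ∑ k, (co X i : ℂ) * ((co X k : ℂ) * ℓ (E i) (E k)) := by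
      conv_lhs => rw [hX X]
      simp only [map_sum, map_smul, FunLike.coe_sum, Finset.sum_apply, FunLike.coe_smul,
        Pi.smul_apply, Complex.real_smul, Finset.mul_sum]
      rw [Finset.sum_comm]
      exact Finset.sum_congr rfl fun i _ => Finset.sum_congr rfl fun k _ => mul_left_comm _ _ _
    rw [h1, h2]
    simp only [map_add, map_sum, map_mul, MvPolynomial.eval_C, MvPolynomial.eval_X,
      Finset.mul_sum]
    congr 1
    · congr 1
      exact Finset.sum_congr rfl fun i _ => mul_comm _ _
    · exact Finset.sum_congr rfl fun i _ => Finset.sum_congr rfl fun k _ => by ring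

/-! ### Linearity in the symbol -/

lemma IsTame.integrable_innerIntegrand (hB : IsTame b B) (f : 𝓢(Config d, ℂ)) (x ξ η : Config d) :
    Integrable fun y => B ((1 / 2 : ℝ) • (x + y), ξ) * phase (-inner ℝ η y) * f y := by
  obtain ⟨C, hC, h⟩ := hB.integrand_bound f
  have := hB.1.continuous
  have := f.continuous
  refine (integrable_decayWeight.const_mul (C * ((1 + ‖x‖) * (1 + ‖ξ‖)) ^ b)).mono'
    (Continuous.aestronglyMeasurable (by fun_prop)) (Filter.Eventually.of_forall fun y => ?_)
  rw [mul_right_comm, norm_mul, norm_phase, mul_one]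
  simpa only [norm_iteratedFDeriv_zero] using h 0 (by lia) x ξ y

lemma IsTame.integrable_weylIntegrand (hB : IsTame b B) (f : 𝓢(Config d, ℂ)) (s : ℝ)
    (p q x ξ : Config d) :
    Integrable fun y => phase (inner ℝ p ((1 / 2 : ℝ) • (x + y))) * phase (inner ℝ q ξ) *
        B ((1 / 2 : ℝ) • (x + y) + s • q, ξ - s • p) * phase (inner ℝ ξ (x - y)) * f y := by
  have := hB.1.continuous
  have := f.continuous
  refine (hB.integrable_innerIntegrand f (x + (2 * s) • q) (ξ - s • p) 0).norm.mono'
    (Continuous.aestronglyMeasurable (by fun_prop)) (Filter.Eventually.of_forall fun y => ?_)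
  have e : (1 / 2 : ℝ) • (x + (2 * s) • q + y) = (1 / 2 : ℝ) • (x + y) + s • q := by module
  simp only [norm_mul, norm_phase, e, one_mul, mul_one, le_refl]

lemma integral_sum_sub {α ι : Type*} [MeasurableSpace α] {ν : Measure α} (σ : Finset ι)
    {F G : ι → α → ℂ} (hF : ∀ j, Integrable (F j) ν) (hG : ∀ j, Integrable (G j) ν) :
    ∫ a, ∑ j ∈ σ, (F j a - G j a) ∂ν = ∑ j ∈ σ, (∫ a, F j a ∂ν - ∫ a, G j a ∂ν) :=
  (integral_finsetSum σ fun j _ => (hF j).sub (hG j)).trans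
    (Finset.sum_congr rfl fun j _ => integral_sub (hF j) (hG j))

lemma integral_sub_sub {α : Type*} [MeasurableSpace α] {ν : Measure α} {F G K : α → ℂ}
    (hF : Integrable F ν) (hG : Integrable G ν) (hK : Integrable K ν) :
    ∫ a, (F a - G a - K a) ∂ν = ∫ a, F a ∂ν - ∫ a, G a ∂ν - ∫ a, K a ∂ν :=
  (integral_sub (hF.sub hG) hK).trans (congrArg (· - _) (integral_sub hF hG))

lemma weylAvg_sum_sub {ι : Type*} (σ : Finset ι) {P Q : ι → Phase d → ℂ}
    (hP : ∀ j, ∃ b, IsTame b (P j)) (hQ : ∀ j, ∃ b, IsTame b (Q j)) (f : 𝓢(Config d, ℂ)) (s : ℝ)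
    (x : Config d) (z : Phase d) :
    weylAvg (fun X => ∑ j ∈ σ, (P j X - Q j X)) f s x z =
      ∑ j ∈ σ, (weylAvg (P j) f s x z - weylAvg (Q j) f s x z) := by
  choose bP hP using hP
  choose bQ hQ using hQ
  have h1 : ∀ ξ, weylInner (fun X => ∑ j ∈ σ, (P j X - Q j X)) f s z.1 z.2 x ξ =
      ∑ j ∈ σ, (weylInner (P j) f s z.1 z.2 x ξ - weylInner (Q j) f s z.1 z.2 x ξ) := by
    intro ξ
    simp only [weylInner, innerIntegral, Finset.sum_mul, sub_mul, ← mul_sub, ← Finset.mul_sum]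
    congr 1
    exact integral_sum_sub σ (fun j => (hP j).integrable_innerIntegrand f _ _ _)
      fun j => (hQ j).integrable_innerIntegrand f _ _ _
  simp only [weylAvg, h1]
  exact integral_sum_sub σ (fun j => (hP j).integrable_weylInner f s _ _ _)
    fun j => (hQ j).integrable_weylInner f s _ _ _

lemma weylAvg_const_mul (c : ℂ) (B : Phase d → ℂ) (f : Config d → ℂ) (s : ℝ) (x : Config d)
    (z : Phase d) : weylAvg (fun X => c * B X) f s x z = c * weylAvg B f s x z := by
  simp only [weylAvg, weylInner, innerIntegral, mul_assoc, integral_const_mul, mul_left_comm _ c]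

/-- The same b serves, since all derivatives of A are bounded. -/
lemma IsTame.schwartz_mul (hB : IsTame b B) (A : 𝓢(Phase d, ℂ)) :
    IsTame b fun X => A X * B X := by
  obtain ⟨hsm, C, hC, h⟩ := hB
  set S := ∑ i ∈ Finset.range (b + d + 2), SchwartzMap.seminorm ℝ 0 i A
  have hS : 0 ≤ S := Finset.sum_nonneg fun i _ => apply_nonneg _ _
  refine ⟨(A.smooth ⊤).mul hsm, 2 ^ (b + d + 1) * (S * C), by positivity, fun n hn X => ?_⟩
  refine (norm_iteratedFDeriv_mul_le (A.smooth ⊤) hsm X (n := n) (mod_cast le_top)).trans ?_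
  calc _ ≤ ∑ i ∈ Finset.range (n + 1), (n.choose i : ℝ) *
        (S * (C * ((1 + ‖X.1‖) * (1 + ‖X.2‖)) ^ b)) := by
        refine Finset.sum_le_sum fun i hi => ?_
        rw [mul_assoc]
        have hi' : i ≤ n := by simpa [Nat.lt_succ_iff] using hi
        gcongr
        · exact (SchwartzMap.norm_iteratedFDeriv_le_seminorm ℝ A i X).trans
            (Finset.single_le_sum (f := fun i => SchwartzMap.seminorm ℝ 0 i A)
              (fun i _ => apply_nonneg _ _) (Finset.mem_range.2 (by lia)))
        · exact h _ (by lia) X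
    _ = 2 ^ n * (S * (C * ((1 + ‖X.1‖) * (1 + ‖X.2‖)) ^ b)) := by
        rw [← Finset.sum_mul, ← Nat.cast_sum, Nat.sum_range_choose]; push_cast; rfl
    _ ≤ 2 ^ (b + d + 1) * (S * (C * ((1 + ‖X.1‖) * (1 + ‖X.2‖)) ^ b)) := by
        gcongr
        exact one_le_two
    _ = _ := by ring

/-- Supplies the joint integrability in (x, ξ) demanded by `eq_zero_of_weyl_eq_zero`. -/
lemma IsTame.integrable_mul_weylInner (hB : IsTame b B) (f g : 𝓢(Config d, ℂ)) (s : ℝ)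
    (p q : Config d) :
    Integrable fun v : Config d × Config d => g v.1 * weylInner B f s p q v.1 v.2 := by
  obtain ⟨a, C, hC, h⟩ := hB.weylInner_bound f s
  have hdom := (integrable_pow_mul_schwartz g a).mul_prod (integrable_decayWeight (d := d))
  refine (hdom.const_mul (C * ((1 + ‖p‖) * (1 + ‖q‖)) ^ a)).mono' ?_
    (Filter.Eventually.of_forall fun v => ?_)
  · have := g.continuous
    have := (hB.continuous_weylInner f s).comp
      (f := fun v : Config d × Config d => (((p, q), v.1), v.2)) (by fun_prop)
    exact Continuous.aestronglyMeasurable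
      (((g.continuous.comp continuous_fst)).mul this)
  · rw [norm_mul]
    calc _ ≤ ‖g v.1‖ * (C * ((1 + ‖p‖) * (1 + ‖q‖) * (1 + ‖v.1‖)) ^ a * decayWeight v.2) := by
          gcongr
          exact h _ _ _ _
      _ = _ := by rw [mul_pow _ (1 + ‖v.1‖)]; ring

lemma IsSymbol.partialX_isTame {μ δ : ℝ} {H : Phase d → ℂ} (hδ : δ < 1) (hH : IsSymbol μ δ H)
    (j : Fin d) : ∃ b, IsTame b (partialX j H) :=
  (hH.fderiv_apply (EuclideanSpace.single j 1, 0)).exists_isTame hδ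

lemma IsSymbol.partialXi_isTame {μ δ : ℝ} {H : Phase d → ℂ} (hδ : δ < 1) (hH : IsSymbol μ δ H)
    (j : Fin d) : ∃ b, IsTame b (partialXi j H) :=
  (hH.fderiv_apply (0, EuclideanSpace.single j 1)).exists_isTame hδ

lemma IsTame.const_mul (hB : IsTame b B) (c : ℂ) : IsTame b fun X => c * B X := by
  obtain ⟨hsm, C, hC, h⟩ := hB
  refine ⟨contDiff_const.mul hsm, ‖c‖ * C, by positivity, fun k hk X => ?_⟩
  have e : iteratedFDeriv ℝ k (fun X => c * B X) X = c • iteratedFDeriv ℝ k B X :=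
    iteratedFDeriv_const_smul_apply (a := c) (hsm.contDiffAt.of_le (mod_cast le_top))
  rw [e, norm_smul, mul_assoc]
  gcongr
  exact h k hk X

/-! ### The Poisson bracket with a tensor product -/

lemma fderiv_tensor_apply (φ ψ : 𝓢(Config d, ℂ)) (X v : Phase d) :
    fderiv ℝ (tensor φ ψ) X v = φ X.1 * fderiv ℝ ψ X.2 v.2 + ψ X.2 * fderiv ℝ φ X.1 v.1 := by
  have h1 : HasFDerivAt (fun X : Phase d => φ X.1)
      ((fderiv ℝ φ X.1).comp (ContinuousLinearMap.fst ℝ _ _)) X :=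
    (φ.hasFDerivAt X.1).comp X hasFDerivAt_fst
  have h2 : HasFDerivAt (fun X : Phase d => ψ X.2)
      ((fderiv ℝ ψ X.2).comp (ContinuousLinearMap.snd ℝ _ _)) X :=
    (ψ.hasFDerivAt X.2).comp X hasFDerivAt_snd
  have h3 : HasFDerivAt (tensor φ ψ) _ X := h1.mul h2
  rw [h3.fderiv]
  simp

variable {μ δ : ℝ} {H : Phase d → ℂ}

/-- The operator identity `i [Op A, Op H] = Op {A, H}`, tested on `A = hat φ ⊗ hat ψ`. -/
lemma weylAvg_identity_of_bracket (hδ : δ < 1 / 2) (hH : IsSymbol μ δ H)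
    (hbracket : ∀ A : 𝓢(Phase d, ℂ), IsMoyalBracket A H (poissonBracket A H))
    (f : 𝓢(Config d, ℂ)) (x : Config d) (z : Phase d) :
    weylAvg H f (1 / 2) x z - weylAvg H f (-(1 / 2)) x z -
      ∑ j : Fin d, ((inner ℝ z.2 (EuclideanSpace.single j 1) : ℝ) * weylAvg (partialX j H) f 0 x z -
        (inner ℝ z.1 (EuclideanSpace.single j 1) : ℝ) * weylAvg (partialXi j H) f 0 x z) = 0 := by
  have hδ1 : δ < 1 := by linarith
  obtain ⟨b, hb⟩ := hH.exists_isTame hδ1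
  choose bP hP using hH.partialX_isTame hδ1
  choose bQ hQ using hH.partialXi_isTame hδ1
  have hcont : ∀ {b : ℕ} {B : Phase d → ℂ} (_ : IsTame b B) (s : ℝ),
      Continuous fun z => weylAvg B f s x z := fun hB s =>
    (hB.continuous_weylAvg f s).comp (f := fun z => (z, x)) (by fun_prop)
  refine eq_zero_of_forall_integral_tensor_mul_eq_zero (M := fun z : Phase d =>
    weylAvg H f (1 / 2) x z - weylAvg H f (-(1 / 2)) x z -
      ∑ j : Fin d, ((inner ℝ z.2 (EuclideanSpace.single j 1) : ℝ) * weylAvg (partialX j H) f 0 x z -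
        (inner ℝ z.1 (EuclideanSpace.single j 1) : ℝ) * weylAvg (partialXi j H) f 0 x z))
    ?_ (fun φ ψ => ?_) z
  · refine ((hcont hb _).sub (hcont hb _)).sub (continuous_finsetSum _ fun j _ => ?_)
    have h1 := hcont (hP j) 0
    have h2 := hcont (hQ j) 0
    refine Continuous.sub (Continuous.mul (by fun_prop) h1) (Continuous.mul (by fun_prop) h2)
  choose χ hχ hχd using fun j : Fin d => exists_fderiv_hat ψ (EuclideanSpace.single j 1)
  choose χ' hχ' hχd' using fun j : Fin d => exists_fderiv_hat φ (EuclideanSpace.single j 1)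
  have hpb : poissonBracket (tensor (hat φ) (hat ψ)) H = fun X => ∑ j : Fin d,
      (tensor (hat φ) (hat (χ j)) X * partialX j H X -
        tensor (hat (χ' j)) (hat ψ) X * partialXi j H X) := by
    ext X
    rw [poissonBracket]
    refine Finset.sum_congr rfl fun j _ => ?_
    have h1 : partialXi j (tensor (hat φ) (hat ψ)) X = tensor (hat φ) (hat (χ j)) X :=
      (fderiv_tensor_apply _ _ _ _).trans (by simp [hχd])
    have h2 : partialX j (tensor (hat φ) (hat ψ)) X = tensor (hat (χ' j)) (hat ψ) X :=
      (fderiv_tensor_apply _ _ _ _).trans (by simp [hχd', mul_comm])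
    rw [h1, h2]
  have hI1 := hb.integrable_tensor_mul_weylAvg φ ψ f (1 / 2) x
  have hI2 := hb.integrable_tensor_mul_weylAvg φ ψ f (-(1 / 2)) x
  -- The density χ j is i q_j ψ, so q_j ψ = -i χ j; this i is matched by the one in the quantum
  -- bracket.
  have eP : ∀ j, (fun z : Phase d => φ z.1 * ψ z.2 *
      ((inner ℝ z.2 (EuclideanSpace.single j 1) : ℝ) * weylAvg (partialX j H) f 0 x z)) =
      fun z => -I * (φ z.1 * χ j z.2 * weylAvg (partialX j H) f 0 x z) := by
    intro j
    ext z
    rw [hχ]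
    linear_combination (φ z.1 * ψ z.2 * weylAvg (partialX j H) f 0 x z *
      (inner ℝ z.2 (EuclideanSpace.single j 1) : ℝ)) * Complex.I_mul_I
  have eQ : ∀ j, (fun z : Phase d => φ z.1 * ψ z.2 *
      ((inner ℝ z.1 (EuclideanSpace.single j 1) : ℝ) * weylAvg (partialXi j H) f 0 x z)) =
      fun z => -I * (χ' j z.1 * ψ z.2 * weylAvg (partialXi j H) f 0 x z) := by
    intro j
    ext z
    rw [hχ']
    linear_combination (φ z.1 * ψ z.2 * weylAvg (partialXi j H) f 0 x z *
      (inner ℝ z.1 (EuclideanSpace.single j 1) : ℝ)) * Complex.I_mul_I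
  have hIP := fun j => (hP j).integrable_tensor_mul_weylAvg φ (χ j) f 0 x
  have hIQ := fun j => (hQ j).integrable_tensor_mul_weylAvg (χ' j) ψ f 0 x
  have hIP' : ∀ j, Integrable (fun z : Phase d => φ z.1 * ψ z.2 *
      ((inner ℝ z.2 (EuclideanSpace.single j 1) : ℝ) * weylAvg (partialX j H) f 0 x z)) :=
    fun j => by rw [eP]; exact (hIP j).const_mul _
  have hIQ' : ∀ j, Integrable (fun z : Phase d => φ z.1 * ψ z.2 *
      ((inner ℝ z.1 (EuclideanSpace.single j 1) : ℝ) * weylAvg (partialXi j H) f 0 x z)) :=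
    fun j => by rw [eQ]; exact (hIQ j).const_mul _
  have hop := (hbracket (tensor (hat φ) (hat ψ))).2 f x
  rw [quantumBracket, hb.weylOp_tensor_weylOp, hb.weylOp_weylOp_tensor, hpb, weylOp_eq,
    weylAvg_sum_sub _ (fun j => ⟨_, (hP j).schwartz_mul _⟩) (fun j => ⟨_, (hQ j).schwartz_mul _⟩),
    Finset.mul_sum] at hop
  have hterm : ∀ j : Fin d, weylConst d *
      (weylAvg (fun X => tensor (hat φ) (hat (χ j)) X * partialX j H X)
          f 0 x 0 -
        weylAvg (fun X => tensor (hat (χ' j)) (hat ψ) X *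
          partialXi j H X) f 0 x 0) =
      weylConst d * ((∫ z : Phase d, φ z.1 * χ j z.2 * weylAvg (partialX j H) f 0 x z) -
        ∫ z : Phase d, χ' j z.1 * ψ z.2 * weylAvg (partialXi j H) f 0 x z) := by
    intro j
    rw [mul_sub, ← weylOp_eq, ← weylOp_eq, (hP j).weylOp_tensor_mul, (hQ j).weylOp_tensor_mul,
      ← mul_sub]
  have hop2 : I * (weylConst d * (∫ z : Phase d, φ z.1 * ψ z.2 * weylAvg H f (1 / 2) x z) -
      weylConst d * ∫ z : Phase d, φ z.1 * ψ z.2 * weylAvg H f (-(1 / 2)) x z) =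
      weylConst d * ∑ j : Fin d,
        ((∫ z : Phase d, φ z.1 * χ j z.2 * weylAvg (partialX j H) f 0 x z) -
          ∫ z : Phase d, χ' j z.1 * ψ z.2 * weylAvg (partialXi j H) f 0 x z) := by
    rw [hop, Finset.mul_sum]
    exact Finset.sum_congr rfl fun j _ => hterm j
  have hsplit : ∫ z : Phase d, φ z.1 * ψ z.2 * (weylAvg H f (1 / 2) x z -
      weylAvg H f (-(1 / 2)) x z - ∑ j : Fin d,
        ((inner ℝ z.2 (EuclideanSpace.single j 1) : ℝ) * weylAvg (partialX j H) f 0 x z -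
        (inner ℝ z.1 (EuclideanSpace.single j 1) : ℝ) * weylAvg (partialXi j H) f 0 x z)) =
      (∫ z : Phase d, φ z.1 * ψ z.2 * weylAvg H f (1 / 2) x z) -
      (∫ z : Phase d, φ z.1 * ψ z.2 * weylAvg H f (-(1 / 2)) x z) - ∑ j : Fin d,
        -I * ((∫ z : Phase d, φ z.1 * χ j z.2 * weylAvg (partialX j H) f 0 x z) -
          ∫ z : Phase d, χ' j z.1 * ψ z.2 * weylAvg (partialXi j H) f 0 x z) := by
    simp only [mul_sub, Finset.mul_sum]
    refine (integral_sub_sub hI1 hI2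
      (integrable_finsetSum _ fun j _ => (hIP' j).sub (hIQ' j))).trans ?_
    congr 1
    refine (integral_sum_sub _ hIP' hIQ').trans (Finset.sum_congr rfl fun j _ => ?_)
    rw [eP, eQ, integral_const_mul, integral_const_mul]
  rw [hsplit, ← Finset.mul_sum]
  refine (mul_eq_zero.1 ?_).resolve_left (mul_ne_zero (weylConst_ne_zero d) Complex.I_ne_zero)
  linear_combination hop2 + (weylConst d * ∑ j : Fin d,
        ((∫ z : Phase d, φ z.1 * χ j z.2 * weylAvg (partialX j H) f 0 x z) -
          ∫ z : Phase d, χ' j z.1 * ψ z.2 * weylAvg (partialXi j H) f 0 x z)) * Complex.I_mul_I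

/-! ### From the operator identity to symmetric differences -/

lemma sum_partial_eq_fderiv (H : Phase d → ℂ) (X z : Phase d) :
    fderiv ℝ H X (z.2, -z.1) = ∑ j : Fin d,
      ((inner ℝ z.2 (EuclideanSpace.single j 1) : ℝ) * partialX j H X -
        (inner ℝ z.1 (EuclideanSpace.single j 1) : ℝ) * partialXi j H X) := by
  have hsingle : ∀ x : Config d, x = ∑ j, inner ℝ x (EuclideanSpace.single j 1) •
      EuclideanSpace.single j (1 : ℝ) := by
    intro x
    ext i
    simp [Pi.single_apply, EuclideanSpace.inner_single_right]
  have hz : (z.2, -z.1) = ∑ j : Fin d, (inner ℝ z.2 (EuclideanSpace.single j 1) •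
      ((EuclideanSpace.single j (1 : ℝ), 0) : Phase d) -
      inner ℝ z.1 (EuclideanSpace.single j 1) •
        ((0, EuclideanSpace.single j (1 : ℝ)) : Phase d)) := by
    ext1
    · simp only [Prod.fst_sum, Prod.fst_sub, Prod.smul_fst, smul_zero, sub_zero]
      exact hsingle z.2
    · simp only [Prod.snd_sum, Prod.snd_sub, Prod.smul_snd, smul_zero, zero_sub,
        Finset.sum_neg_distrib]
      rw [← hsingle z.1]
  rw [hz, map_sum]
  simp only [map_sub, map_smul, Complex.real_smul, partialX, partialXi]

/-- Collects the Poisson side into the quantization of a single symbol, e_z times the derivative of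
H along (q, -p). -/
lemma weylAvg_fderiv_eq_sum (hδ : δ < 1) (hH : IsSymbol μ δ H) (f : 𝓢(Config d, ℂ))
    (x : Config d) (z : Phase d) :
    weylAvg (fun X => fderiv ℝ H X (z.2, -z.1)) f 0 x z = ∑ j : Fin d,
      ((inner ℝ z.2 (EuclideanSpace.single j 1) : ℝ) * weylAvg (partialX j H) f 0 x z -
        (inner ℝ z.1 (EuclideanSpace.single j 1) : ℝ) * weylAvg (partialXi j H) f 0 x z) := by
  have e : (fun X => fderiv ℝ H X (z.2, -z.1)) = _ := funext fun X => sum_partial_eq_fderiv H X z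
  rw [e, weylAvg_sum_sub _
    (fun j => (hH.partialX_isTame hδ j).imp fun _ h => h.const_mul _)
    (fun j => (hH.partialXi_isTame hδ j).imp fun _ h => h.const_mul _)]
  refine Finset.sum_congr rfl fun j _ => ?_
  rw [weylAvg_const_mul, weylAvg_const_mul]

/-- If the Moyal and Poisson brackets with `H` agree, the symmetric differences of `H` are given by
its derivative. -/
lemma symmetric_difference_eq (hδ : δ < 1 / 2) (hH : IsSymbol μ δ H)
    (hbracket : ∀ A : 𝓢(Phase d, ℂ), IsMoyalBracket A H (poissonBracket A H)) (X Z : Phase d) :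
    H (X + Z) - H (X - Z) = 2 * fderiv ℝ H X Z := by
  have hδ1 : δ < 1 := by linarith
  -- Chosen so that (q/2, -p/2) = Z, the half-shift attached to e_z.
  set p : Config d := (-2 : ℝ) • Z.2 with hp
  set q : Config d := (2 : ℝ) • Z.1 with hq
  set D : Phase d → ℂ := fun X => fderiv ℝ H X (q, -p)
  have hZ : ∀ X : Phase d, X + Z = (X.1 + (1 / 2 : ℝ) • q, X.2 - (1 / 2 : ℝ) • p) := by
    intro X
    ext1
    · simp only [Prod.fst_add, hq]; module
    · simp only [Prod.snd_add, hp]; module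
  have hZ' : ∀ X : Phase d, X + -Z = (X.1 + (-(1 / 2) : ℝ) • q, X.2 - (-(1 / 2) : ℝ) • p) := by
    intro X
    ext1
    · simp only [Prod.fst_add, Prod.fst_neg, hq]; module
    · simp only [Prod.snd_add, Prod.snd_neg, hp]; module
  have hqp : ((q, -p) : Phase d) = (2 : ℝ) • Z := by
    ext1
    · simp [hq]
    · simp [hp]
  obtain ⟨b, hb⟩ := hH.exists_isTame hδ1
  obtain ⟨b', hb'⟩ : ∃ b', IsTame b' D := (hH.fderiv_apply (q, -p)).exists_isTame hδ1
  have hHc := hb.1.continuous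
  have hDc : Continuous D := hb'.1.continuous
  set S : Phase d → ℂ := fun X => H (X + Z) - H (X + -Z) - D X with hS
  -- F is e_z times the defect S; the identity for z = (p, q) says that its quantization vanishes,
  -- and e_z has no zeros.
  set F : Phase d → ℂ := fun X => phase (inner ℝ p X.1) * phase (inner ℝ q X.2) * S X with hF
  have hinner : ∀ (f : 𝓢(Config d, ℂ)) (x ξ : Config d),
      ∫ y, F ((1 / 2 : ℝ) • (x + y), ξ) * phase (inner ℝ ξ (x - y)) * f y =
        weylInner H f (1 / 2) p q x ξ - weylInner H f (-(1 / 2)) p q x ξ -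
          weylInner D f 0 p q x ξ := by
    intro f x ξ
    rw [weylInner_eq, weylInner_eq, weylInner_eq,
      ← integral_sub_sub (hb.integrable_weylIntegrand f _ _ _ _ _)
        (hb.integrable_weylIntegrand f _ _ _ _ _) (hb'.integrable_weylIntegrand f _ _ _ _ _)]
    congr with y
    simp only [hF, hS, hZ, hZ', zero_smul, add_zero, sub_zero]
    ring
  have hzero : F X = 0 := by
    refine eq_zero_of_weyl_eq_zero ?_ ?_ (fun f g => ?_) (fun f x => ?_) X
    · have hpb : IsPolyBounded S := ((hb.isPolyBounded.comp_add Z).sub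
        (hb.isPolyBounded.comp_add (-Z))).sub hb'.isPolyBounded
      obtain ⟨a, C, hC, h⟩ := hpb
      exact ⟨a, C, hC, fun X => by simpa [hF] using h X⟩
    · simp only [hF, hS]
      fun_prop
    · simp only [hinner, mul_sub]
      exact ((hb.integrable_mul_weylInner f g _ p q).sub
        (hb.integrable_mul_weylInner f g _ p q)).sub (hb'.integrable_mul_weylInner f g _ p q)
    · simp only [hinner]
      rw [integral_sub_sub (hb.integrable_weylInner f _ p q x)
        (hb.integrable_weylInner f _ p q x) (hb'.integrable_weylInner f _ p q x)]
      have h1 := weylAvg_identity_of_bracket hδ hH hbracket f x (p, q)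
      rw [← weylAvg_fderiv_eq_sum hδ1 hH f x (p, q)] at h1
      exact h1
  have hSX : S X = 0 :=
    (mul_eq_zero.1 hzero).resolve_left (mul_ne_zero (phase_ne_zero _) (phase_ne_zero _))
  have hD : D X = 2 * fderiv ℝ H X Z := by
    simp only [D, hqp, map_smul, Complex.real_smul]
    norm_num
  rw [← hD, sub_eq_add_neg X Z]
  exact sub_eq_zero.1 hSX

end MoyalPoisson

end

theorem theorem1 (d : ℕ) (μ δ : ℝ) (hδ : δ < 1 / 2)
    (H : MoyalPoisson.Phase d → ℂ) (hH : MoyalPoisson.IsSymbol μ δ H)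
    (hbracket : ∀ A : SchwartzMap (MoyalPoisson.Phase d) ℂ,
      MoyalPoisson.IsMoyalBracket A H (MoyalPoisson.poissonBracket A H)) :
    MoyalPoisson.IsPolynomialOfDegreeLE 2 H := by
  obtain ⟨ℓ, h⟩ := MoyalPoisson.eq_quadratic_of_symmetric_difference
    (hH.1.of_le (mod_cast le_top))
    (MoyalPoisson.symmetric_difference_eq hδ hH hbracket)
  exact MoyalPoisson.isPolynomialOfDegreeLE_two _ _ ℓ h
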